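/- For an $n\times n$ matrix $A$ with entries in $\{0,1\}$, the $k$-deck of $A$ is the multiset of all $\binom{n}{k}^2$ submatrices of order $k\times k$ obtained by deleting $n-k$ rows and $n-k$ columns of $A$, and the principal $k$-deck of $A$ is the multiset of all $\binom{n}{k}$ principal submatrices of order $k\times k$ (the deleted rows and columns have the same indices). Let $\kappa_2(n)$, respectively $\kappa_2^{\mathrm p}(n)$, be the smallest $k$ such that any two distinct $n\times n$ matrices with entries in $\{0,1\}$ have distinct $k$-decks, respectively distinct principal $k$-decks. Write $[n]=\{1,\dots,n\}$. Theorem. There is an $n_0$ such that the following hold for all $n\ge n_0$. For every nonempty set $H\subset[n]^2$ there exist a polynomial $p(x,y)$ with real coefficients and total degree $\deg p\le 6.308\,n^{2/3}-2$ and a point $\mathbf h=(h_1,h_2)\in H$ such that $$p(h_1,h_2)>\sum_{(x,y)\in H\setminus\{\mathbf h\}}|p(x,y)|.$$ Consequently, $\kappa_2(n)\le 6.308\,n^{2/3}$ and $\kappa_2^{\mathrm p}(n)\le 6.308\,n^{2/3}$. -/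

import Mathlib

open Filter

/-- An `n × n` binary matrix (entries in `{0, 1}`). -/
abbrev BinMatrix (n : ℕ) : Type := Matrix (Fin n) (Fin n) (Fin 2)

/-- The `k`-deck of an `n × n` binary matrix: the multiset of all its `k × k` submatrices, obtained
by keeping `k` rows and `k` columns (in their order), i.e. by deleting `n - k` rows and `n - k`
columns. A choice of `k` of the `n` indices is an order embedding `Fin k ↪o Fin n`. -/
noncomputable def deck {n : ℕ} (k : ℕ) (A : BinMatrix n) : Multiset (BinMatrix k) :=
  (Finset.univ : Finset ((Fin k ↪o Fin n) × (Fin k ↪o Fin n))).val.map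
    fun rc => A.submatrix rc.1 rc.2

/-- The principal `k`-deck: the multiset of all principal `k × k` submatrices (the same indices are
kept for the rows and for the columns). -/
noncomputable def principalDeck {n : ℕ} (k : ℕ) (A : BinMatrix n) : Multiset (BinMatrix k) :=
  (Finset.univ : Finset (Fin k ↪o Fin n)).val.map
    fun r : Fin k ↪o Fin n => A.submatrix r r

/-- `κ₂(n)`: the smallest `k` such that every `n × n` binary matrix is determined by its
`k`-deck. -/
noncomputable def kappa₂ (n : ℕ) : ℕ :=
  sInf {k : ℕ | Function.Injective (deck k : BinMatrix n → Multiset (BinMatrix k))}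

/-- `κ₂ᵖ(n)`: the smallest `k` such that every `n × n` binary matrix is determined by its
principal `k`-deck. -/
noncomputable def kappaP₂ (n : ℕ) : ℕ :=
  sInf {k : ℕ | Function.Injective (principalDeck k : BinMatrix n → Multiset (BinMatrix k))}

theorem orderEmbedding_self_eq_id {n : ℕ} (f : Fin n ↪o Fin n) : (f : Fin n → Fin n) = id := by
  refine (StrictMono.range_inj f.strictMono strictMono_id).1 ?_
  rw [(Finite.injective_iff_surjective.1 f.injective).range_eq, Set.range_id]

theorem mem_deck_self_iff {n : ℕ} (A B : BinMatrix n) : B ∈ deck n A ↔ B = A := by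
  have key : ∀ f : Fin n ↪o Fin n, (f : Fin n → Fin n) = id := orderEmbedding_self_eq_id
  constructor
  · intro h
    obtain ⟨⟨r, c⟩, -, rfl⟩ := Multiset.mem_map.1 h
    simp [key r, key c]
  · rintro rfl
    exact Multiset.mem_map.2
      ⟨(RelEmbedding.refl _, RelEmbedding.refl _), Finset.mem_univ _, rfl⟩

theorem mem_principalDeck_self_iff {n : ℕ} (A B : BinMatrix n) :
    B ∈ principalDeck n A ↔ B = A := by
  have key : ∀ f : Fin n ↪o Fin n, (f : Fin n → Fin n) = id := orderEmbedding_self_eq_id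
  constructor
  · intro h
    obtain ⟨r, -, rfl⟩ := Multiset.mem_map.1 h
    simp [key r]
  · rintro rfl
    exact Multiset.mem_map.2 ⟨RelEmbedding.refl _, Finset.mem_univ _, rfl⟩

/-- The minimum defining `κ₂(n)` is attained (the set is nonempty, since `k = n` works). -/
theorem isLeast_kappa₂ (n : ℕ) :
    IsLeast {k : ℕ | Function.Injective (deck k : BinMatrix n → Multiset (BinMatrix k))}
      (kappa₂ n) := by
  refine ⟨Nat.sInf_mem ⟨n, fun A B h => ?_⟩, fun k hk => Nat.sInf_le hk⟩
  exact (mem_deck_self_iff B A).1 (h ▸ (mem_deck_self_iff A A).2 rfl)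

/-- The minimum defining `κ₂ᵖ(n)` is attained (the set is nonempty, since `k = n` works). -/
theorem isLeast_kappaP₂ (n : ℕ) :
    IsLeast {k : ℕ | Function.Injective (principalDeck k : BinMatrix n → Multiset (BinMatrix k))}
      (kappaP₂ n) := by
  refine ⟨Nat.sInf_mem ⟨n, fun A B h => ?_⟩, fun k hk => Nat.sInf_le hk⟩
  exact (mem_principalDeck_self_iff B A).1 (h ▸ (mem_principalDeck_self_iff A A).2 rfl)

/-! Peak polynomial. For a rational `t` in `[0,1]` consider the linear form `(1-t)x + ty` on `H`. If
two distinct fractions `t`, `t'` with denominators at most `m` have a common maximiser `h`, then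
clearing denominators in the drops of the two forms below their values at `h` gives integers `u(x)`,
`u'(x)` in `{0, …, mn}`. Both vanish at `h`, and together they determine `x`. Take a univariate `G`
of degree at most `e` with `G(0) = 1` and `∑ G² < √2` over `{0, …, mn}`. Then `p = G(u)² G(u')²` is
nonnegative, equals 1 at `h`, and has sum less than `√2² = 2` over `H`, so the other points
contribute less than 1 (`exists_peak_of_common_max`).

Common maximiser. If all Farey fractions of order `m` had different maximisers, then `y - x` at the
maximiser would grow by at least `m + 1` between neighbouring fractions (`fareySet_gap`). But `y -
x` varies by less than `2n`, and there are at least `(m+1)²/4` gaps, so `m ≈ 2n^(1/3)` is a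
contradiction (`exists_common_max`).

Univariate polynomial. Minimising `∑ G²` subject to `G(0) = 1` makes `G` orthogonal to all `x·q`
with `deg q < e`. Thus `G` is an orthogonal polynomial for the weight `x`, a Hahn polynomial, and
the minimum has a closed form (`exists_poly_sum_sq_lt`). Degree about `√(1.235·mn)` suffices, which
is of order `n^(2/3)`.

Decks. Equal `k`-decks force `A - B` to annihilate every polynomial of total degree at most `k - 2`;
for principal decks this holds separately on, above and below the diagonal. A peak polynomial for
the support of `A - B`, whose nonzero entries are `±1`, contradicts this
(`eq_on_of_sum_binDiff_eq_zero`). -/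

/-! ### Finite differences and binomial sums -/

-- The sum is, up to the sign `(-1)^e`, the `e`-th forward difference at 0, which only sees the
-- coefficient of degree `e`.
open Polynomial in
theorem alternating_sum_choose_mul_eval (P : ℝ[X]) {e : ℕ} (h : P.natDegree ≤ e) :
    ∑ j ∈ Finset.range (e + 1), (-1 : ℝ) ^ j * (e.choose j : ℝ) * P.eval (j : ℝ) =
      (-1) ^ e * (e.factorial : ℝ) * P.coeff e := by
  have key : (fwdDiff (1 : ℝ))^[e] P.eval 0 = (e.factorial : ℝ) * P.coeff e := by
    rcases h.lt_or_eq with h | h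
    · rw [Polynomial.fwdDiff_iter_eq_zero_of_degree_lt h, Polynomial.coeff_eq_zero_of_natDegree_lt h]
      simp
    · subst h
      rw [Polynomial.fwdDiff_iter_degree_eq_factorial]
      simp [mul_comm]
  rw [fwdDiff_iter_eq_sum_shift] at key
  rw [mul_assoc, ← key, Finset.mul_sum]
  refine Finset.sum_congr rfl fun j hj => ?_
  have hj' : j ≤ e := Nat.lt_succ_iff.1 (Finset.mem_range.1 hj)
  obtain ⟨d, rfl⟩ := Nat.exists_eq_add_of_le hj'
  have : ((-1 : ℝ) ^ d) * (-1) ^ d = 1 := by rw [← mul_pow]; simp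
  simp only [zsmul_eq_mul, Nat.add_sub_cancel_left, zero_add, nsmul_eq_mul, mul_one]
  push_cast
  rw [pow_add]
  linear_combination (-(-1) ^ j * ((j + d).choose j : ℝ) * P.eval (j : ℝ)) * this

theorem eval_eq_sum_choose_mul (P : Polynomial ℝ) {d : ℕ} (h : P.natDegree ≤ d) :
    ∃ a : ℕ → ℝ, a 0 = P.eval 0 ∧
      ∀ x : ℕ, P.eval (x : ℝ) = ∑ k ∈ Finset.range (d + 1), a k * (x.choose k : ℝ) := by
  refine ⟨fun k => (fwdDiff (1 : ℝ))^[k] P.eval 0, by simp, fun x => ?_⟩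
  have h1 := shift_eq_sum_fwdDiff_iter (1 : ℝ) P.eval x 0
  have h2 : ∀ k, d < k → (fwdDiff (1 : ℝ))^[k] P.eval 0 = 0 := fun k hk => by
    rw [Polynomial.fwdDiff_iter_eq_zero_of_degree_lt (h.trans_lt hk)]; rfl
  simp only [zero_add, nsmul_eq_mul, mul_one] at h1
  rw [h1, Finset.sum_subset (Finset.range_mono (by omega : x + 1 ≤ x + d + 1)),
    Finset.sum_subset (s₁ := Finset.range (d + 1))
      (Finset.range_mono (by omega : d + 1 ≤ x + d + 1))]
  · exact Finset.sum_congr rfl fun _ _ => mul_comm _ _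
  · intro k _ hk
    have := h2 k (by simpa using hk)
    simp [this]
  · intro k _ hk
    rw [Nat.choose_eq_zero_of_lt (by simpa using hk)]; simp

/-- Combinatorially, an `(a+b+1)`-subset of `{0, …, N}` is sorted by its element `y` that has `b`
elements below it and `a` above. -/
theorem sum_choose_sub_mul_choose (N a b : ℕ) :
    ∑ y ∈ Finset.range (N + 1), (N - y).choose a * y.choose b = (N + 1).choose (a + b + 1) := by
  induction N generalizing b with
  | zero =>
    rcases a with _ | a <;> rcases b with _ | b <;> simp [Nat.choose_eq_zero_of_lt]
  | succ N ih =>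
    rw [Finset.sum_range_succ']
    simp only [Nat.add_sub_add_right]
    rcases b with _ | b
    · have := ih 0
      simp only [Nat.choose_zero_right, mul_one, Nat.sub_zero, add_zero] at this ⊢
      rw [this, Nat.choose_succ_succ (N + 1) a, add_comm]
    · simp only [Nat.choose_succ_succ _ b, mul_add, Finset.sum_add_distrib, ih]
      simp only [Nat.choose_zero_succ, mul_zero, add_zero]
      rw [Nat.choose_succ_succ (N + 1), show a + (b + 1) = a + b + 1 by ring]

theorem alternating_sum_choose_div (e : ℕ) {W : ℕ} (h : e ≤ W) :
    ∑ j ∈ Finset.range (e + 1), (-1 : ℝ) ^ j * (e.choose j : ℝ) / ((W : ℝ) + 1 - j) =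
      (-1) ^ e * (e.factorial : ℝ) / ((W + 1).descFactorial (e + 1) : ℝ) := by
  -- The base point `y` is left free because each difference step uses the formula at `y` and at `y
  -- + 1`.
  have key : ∀ (e : ℕ) (y : ℕ), e + y ≤ W →
      (fwdDiff 1)^[e] (fun j : ℕ => 1 / ((W : ℝ) + 1 - j)) y =
        (e.factorial : ℝ) / ((W + 1 - y).descFactorial (e + 1) : ℝ) := by
    intro e
    induction e with
    | zero =>
      intro y hy
      simp [Nat.cast_sub (show y ≤ W + 1 by omega)]
    | succ e ih =>
      intro y hy
      rw [Function.iterate_succ_apply', fwdDiff, ih (y + 1) (by omega), ih y (by omega)]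
      obtain ⟨c, rfl⟩ : ∃ c, W = e + 1 + y + c := Nat.exists_eq_add_of_le hy
      have e1 : e + 1 + y + c + 1 - (y + 1) = e + 1 + c := by omega
      have e2 : e + 1 + y + c + 1 - y = e + 1 + c + 1 := by omega
      rw [e1, e2, Nat.succ_descFactorial_succ, Nat.succ_descFactorial_succ,
        Nat.descFactorial_succ _ e, Nat.factorial_succ]
      have e3 : e + 1 + c - e = c + 1 := by omega
      rw [e3]
      have : ((e + 1 + c).descFactorial e : ℝ) ≠ 0 := by
        have := Nat.descFactorial_pos (n := e + 1 + c) (k := e)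
        exact_mod_cast (this.2 (by omega)).ne'
      have h2 : (c : ℝ) + 1 ≠ 0 := by positivity
      have h3 : (e : ℝ) + 1 + c + 1 ≠ 0 := by positivity
      push_cast
      field_simp
      ring
  have := key e 0 (by omega)
  rw [fwdDiff_iter_eq_sum_shift] at this
  rw [mul_div_assoc]
  simp only [Nat.sub_zero] at this
  rw [← this, Finset.mul_sum]
  refine Finset.sum_congr rfl fun j hj => ?_
  have hj' : j ≤ e := Nat.lt_succ_iff.1 (Finset.mem_range.1 hj)
  obtain ⟨d, rfl⟩ := Nat.exists_eq_add_of_le hj'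
  have : ((-1 : ℝ) ^ d) * (-1) ^ d = 1 := by rw [← mul_pow]; simp
  simp only [zsmul_eq_mul, Nat.add_sub_cancel_left, zero_add, smul_eq_mul, mul_one]
  push_cast
  rw [pow_add]
  linear_combination (-(-1) ^ j * ((j + d).choose j : ℝ) / ((W : ℝ) + 1 - j)) * this

/-! ### Hahn polynomials and the extremal univariate polynomial -/

/-- Coefficients, in the basis `y.choose j`, of the discrete orthogonal polynomial of degree `e`
on `{0, …, W + 1}` for the weight `W + 1 - y`. -/
noncomputable def hahnCoeff (W e j : ℕ) : ℝ :=
  (-1) ^ j * (e.choose j : ℝ) * ((e + 1 + j).choose j : ℝ) / (W.choose j : ℝ)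

/-- The discrete orthogonal polynomial of degree `e` on `{0, …, W + 1}` for the weight
`W + 1 - y`. -/
noncomputable def hahnPoly (W e : ℕ) : Polynomial ℝ :=
  ∑ j ∈ Finset.range (e + 1), Polynomial.C (hahnCoeff W e j / (j.factorial : ℝ)) *
    descPochhammer ℝ j

theorem natDegree_hahnPoly_le (W e : ℕ) : (hahnPoly W e).natDegree ≤ e := by
  refine Polynomial.natDegree_sum_le_of_forall_le _ _ fun j hj => ?_
  refine (Polynomial.natDegree_C_mul_le _ _).trans ?_
  rw [descPochhammer_natDegree]
  exact Nat.lt_succ_iff.1 (Finset.mem_range.1 hj)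

theorem hahnPoly_eval (W e y : ℕ) : (hahnPoly W e).eval (y : ℝ) =
    ∑ j ∈ Finset.range (e + 1), hahnCoeff W e j * (y.choose j : ℝ) := by
  rw [hahnPoly, Polynomial.eval_finsetSum]
  refine Finset.sum_congr rfl fun j _ => ?_
  rw [Polynomial.eval_mul, Polynomial.eval_C, descPochhammer_eval_eq_descFactorial,
    Nat.descFactorial_eq_factorial_mul_choose]
  have : (j.factorial : ℝ) ≠ 0 := by positivity
  push_cast
  field_simp

/-- Apart from `(-1)^j * e.choose j`, the right side is a polynomial in `j` of degree `(e-1-i) + i =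
e - 1`, so its alternating sum over `j` vanishes. This is the source of orthogonality. -/
theorem hahnCoeff_mul_choose_add {W e i j : ℕ} (hj : j ≤ e) (he : e ≤ W) (hi : i < e) :
    hahnCoeff W e j * ((W + 2).choose (i + j + 2) : ℝ) =
      (-1) ^ j * (e.choose j : ℝ) * (((W + 1 : ℝ) * (W + 2) / ((e + 1).factorial : ℝ)) *
        (((i + j + 3).ascFactorial (e - 1 - i) : ℝ) * ((W - j).descFactorial i : ℝ))) := by
  have h1 : (i + j + 2).factorial * (W + 2).choose (i + j + 2) =
      (W + 2) * (W + 1) * ((j.factorial * W.choose j) * (W - j).descFactorial i) := by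
    rw [← Nat.descFactorial_eq_factorial_mul_choose, ← Nat.descFactorial_eq_factorial_mul_choose,
      Nat.succ_descFactorial_succ, Nat.succ_descFactorial_succ, add_comm i j,
      ← Nat.descFactorial_mul_descFactorial (n := W) (k := j) (m := j + i) (by omega),
      Nat.add_sub_cancel_left]
    ring
  have h2 : (i + j + 2).factorial * (i + j + 3).ascFactorial (e - 1 - i) =
      (j.factorial * (e + 1).factorial) * (e + 1 + j).choose j := by
    rw [Nat.factorial_mul_ascFactorial, show i + j + 2 + (e - 1 - i) = e + 1 + j by omega,
      ← Nat.choose_mul_factorial_mul_factorial (show j ≤ e + 1 + j by omega),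
      Nat.add_sub_cancel]
    ring
  have h1' := congrArg (Nat.cast : ℕ → ℝ) h1
  have h2' := congrArg (Nat.cast : ℕ → ℝ) h2
  push_cast at h1' h2'
  have p1 : ((i + j + 2).factorial : ℝ) ≠ 0 := by positivity
  have p2 : ((e + 1).factorial : ℝ) ≠ 0 := by positivity
  have p3 : (W.choose j : ℝ) ≠ 0 := by
    exact_mod_cast (Nat.choose_pos (hj.trans he)).ne'
  have p4 : (j.factorial : ℝ) ≠ 0 := by positivity
  rw [hahnCoeff]
  have e1 : ((W + 2).choose (i + j + 2) : ℝ) = (W + 2) * (W + 1) *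
      ((j.factorial * W.choose j) * (W - j).descFactorial i) / (i + j + 2).factorial := by
    rw [← h1']; field_simp
  have e2 : ((e + 1 + j).choose j : ℝ) = (i + j + 2).factorial *
      (i + j + 3).ascFactorial (e - 1 - i) / (j.factorial * (e + 1).factorial) := by
    rw [h2']; field_simp
  rw [e1, e2]
  field_simp

/-- These are the terms of the plain sum of the polynomial and of its value at `W + 1`. Unlike in
the orthogonality relations, a pole at `j = W + 1` survives. -/
theorem hahnCoeff_mul_choose_succ {W e j : ℕ} (hj : j ≤ e) (he : e ≤ W) :
    hahnCoeff W e j * ((W + 2).choose (j + 1) : ℝ) =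
      ((W + 1 : ℝ) * (W + 2) / ((e + 1).factorial : ℝ)) * ((-1) ^ j * (e.choose j : ℝ) *
        (((j + 2).ascFactorial e : ℝ) / ((W : ℝ) + 1 - j))) ∧
    hahnCoeff W e j * ((W + 1).choose j : ℝ) =
      ((W + 1 : ℝ) / ((e + 1).factorial : ℝ)) * ((-1) ^ j * (e.choose j : ℝ) *
        (((j : ℝ) + 1) * ((j + 2).ascFactorial e : ℝ) / ((W : ℝ) + 1 - j))) := by
  have hW : ((W : ℝ) + 1 - j) ≠ 0 := by
    have : (j : ℝ) ≤ W := by exact_mod_cast hj.trans he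
    linarith
  have h1 : ((W + 1).choose j : ℝ) * ((W : ℝ) + 1 - j) = (W.choose j : ℝ) * (W + 1) := by
    have := Nat.choose_mul_succ_eq W j
    have := congrArg (Nat.cast : ℕ → ℝ) this
    rw [Nat.cast_mul, Nat.cast_mul, Nat.cast_sub (by omega)] at this
    push_cast at this
    linarith
  have h3 : ((W + 2).choose (j + 1) : ℝ) * ((j : ℝ) + 1) = (W + 2) * ((W + 1).choose j : ℝ) := by
    have := Nat.add_one_mul_choose_eq (W + 1) j
    have := congrArg (Nat.cast : ℕ → ℝ) this
    push_cast at this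
    linarith
  have h2 : (j + 1).factorial * (j + 2).ascFactorial e =
      (j.factorial * (e + 1).factorial) * (e + 1 + j).choose j := by
    rw [Nat.factorial_mul_ascFactorial, show j + 1 + e = e + 1 + j by omega,
      ← Nat.choose_mul_factorial_mul_factorial (show j ≤ e + 1 + j by omega),
      Nat.add_sub_cancel]
    ring
  rw [Nat.factorial_succ] at h2
  have h2' := congrArg (Nat.cast : ℕ → ℝ) h2
  push_cast at h2'
  have p2 : ((e + 1).factorial : ℝ) ≠ 0 := by positivity
  have p3 : (W.choose j : ℝ) ≠ 0 := by
    exact_mod_cast (Nat.choose_pos (hj.trans he)).ne'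
  have p4 : (j.factorial : ℝ) ≠ 0 := by positivity
  have p5 : (j : ℝ) + 1 ≠ 0 := by positivity
  have e1 : ((W + 1).choose j : ℝ) = (W.choose j : ℝ) * (W + 1) / ((W : ℝ) + 1 - j) := by
    rw [← h1]; field_simp
  have e3 : ((W + 2).choose (j + 1) : ℝ) = (W + 2) * ((W + 1).choose j : ℝ) / ((j : ℝ) + 1) := by
    rw [← h3]; field_simp
  have e2 : ((e + 1 + j).choose j : ℝ) = ((j : ℝ) + 1) * (j + 2).ascFactorial e /
      (e + 1).factorial := by
    rw [eq_div_iff p2]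
    apply mul_left_cancel₀ p4
    linarith
  rw [e3, e1, hahnCoeff, e2]
  constructor <;> field_simp

theorem sum_choose_mul_hahnPoly {W e : ℕ} (a : ℕ) :
    ∑ y ∈ Finset.range (W + 2), ((W + 1 - y).choose a : ℝ) * (hahnPoly W e).eval (y : ℝ) =
      ∑ j ∈ Finset.range (e + 1), hahnCoeff W e j * ((W + 2).choose (a + j + 1) : ℝ) := by
  simp only [hahnPoly_eval, Finset.mul_sum]
  rw [Finset.sum_comm]
  refine Finset.sum_congr rfl fun j _ => ?_
  rw [← sum_choose_sub_mul_choose]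
  push_cast
  rw [Finset.mul_sum]
  exact Finset.sum_congr rfl fun y _ => by ring

/-- As `(W+1-y).choose (i+1)` is `W + 1 - y` times a polynomial in `y` of degree `i`, this is
orthogonality to all degrees below `e` for the weight `W + 1 - y`. -/
theorem hahnPoly_orthogonal {W e i : ℕ} (he : e ≤ W) (hi : i < e) :
    ∑ y ∈ Finset.range (W + 2), ((W + 1 - y).choose (i + 1) : ℝ) *
      (hahnPoly W e).eval (y : ℝ) = 0 := by
  rw [sum_choose_mul_hahnPoly]
  set K : ℝ := (W + 1 : ℝ) * (W + 2) / ((e + 1).factorial : ℝ)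
  set P : Polynomial ℝ := Polynomial.C K *
    ((ascPochhammer ℝ (e - 1 - i)).comp (Polynomial.X + Polynomial.C ((i : ℝ) + 3)) *
      (descPochhammer ℝ i).comp (Polynomial.C (W : ℝ) - Polynomial.X)) with hP
  have hdeg : P.natDegree < e := by
    have h1 : (Polynomial.X + Polynomial.C ((i : ℝ) + 3)).natDegree = 1 :=
      Polynomial.natDegree_X_add_C _
    have h2 : (Polynomial.C (W : ℝ) - Polynomial.X).natDegree ≤ 1 := by
      refine (Polynomial.natDegree_sub_le _ _).trans ?_
      simp
    have h3 := Polynomial.natDegree_comp_le (p := ascPochhammer ℝ (e - 1 - i))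
      (q := Polynomial.X + Polynomial.C ((i : ℝ) + 3))
    have h4 := Polynomial.natDegree_comp_le (p := descPochhammer ℝ i)
      (q := Polynomial.C (W : ℝ) - Polynomial.X)
    rw [h1, ascPochhammer_natDegree, mul_one] at h3
    rw [descPochhammer_natDegree] at h4
    have h5 : i * (Polynomial.C (W : ℝ) - Polynomial.X).natDegree ≤ i * 1 :=
      Nat.mul_le_mul_left _ h2
    refine ((Polynomial.natDegree_C_mul_le _ _).trans Polynomial.natDegree_mul_le).trans_lt ?_
    omega
  have := alternating_sum_choose_mul_eval P hdeg.le
  rw [Polynomial.coeff_eq_zero_of_natDegree_lt hdeg, mul_zero] at this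
  rw [← this]
  refine Finset.sum_congr rfl fun j hj => ?_
  have hj' : j ≤ e := Nat.lt_succ_iff.1 (Finset.mem_range.1 hj)
  rw [show i + 1 + j + 1 = i + j + 2 by ring, hahnCoeff_mul_choose_add hj' he hi, hP]
  simp only [Polynomial.eval_mul, Polynomial.eval_C, Polynomial.eval_comp, Polynomial.eval_add,
    Polynomial.eval_sub, Polynomial.eval_X]
  rw [← Nat.cast_sub (hj'.trans he), descPochhammer_eval_eq_descFactorial]
  have : (j : ℝ) + ((i : ℝ) + 3) = ((i + j + 3 : ℕ) : ℝ) := by push_cast; ring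
  rw [this, ← Nat.cast_ascFactorial]

/-- Division by `X - (W+1)` leaves a quotient of degree below `e`, killed by the `e`-th difference,
so only the remainder `P(W+1)` over the linear factor counts. -/
theorem alternating_sum_choose_mul_eval_div (P : Polynomial ℝ) {e W : ℕ} (h : P.natDegree ≤ e)
    (he : e ≤ W) :
    ∑ j ∈ Finset.range (e + 1), (-1 : ℝ) ^ j * (e.choose j : ℝ) *
        (P.eval (j : ℝ) / ((W : ℝ) + 1 - j)) =
      P.eval ((W : ℝ) + 1) *
        ((-1) ^ e * (e.factorial : ℝ) / ((W + 1).descFactorial (e + 1) : ℝ)) := by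
  set V := P /ₘ (Polynomial.X - Polynomial.C ((W : ℝ) + 1)) with hV
  have hdeg : V.natDegree = P.natDegree - 1 := by
    rw [hV, Polynomial.natDegree_divByMonic _ (Polynomial.monic_X_sub_C _),
      Polynomial.natDegree_X_sub_C]
  have hc : V.coeff e = 0 := by
    rcases Nat.eq_zero_or_pos e with rfl | hpos
    · have : V = 0 := by
        rw [hV, Polynomial.divByMonic_eq_zero_iff (Polynomial.monic_X_sub_C _),
          Polynomial.degree_X_sub_C]
        exact Polynomial.degree_le_natDegree.trans_lt (by exact_mod_cast (by omega))
      rw [this, Polynomial.coeff_zero]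
    · exact Polynomial.coeff_eq_zero_of_natDegree_lt (by omega)
  have h0 := alternating_sum_choose_mul_eval V (e := e) (by omega)
  rw [hc, mul_zero] at h0
  rw [← alternating_sum_choose_div e he, Finset.mul_sum]
  have hPV : ∀ x : ℝ, P.eval x = P.eval ((W : ℝ) + 1) + (x - ((W : ℝ) + 1)) * V.eval x := by
    intro x
    conv_lhs => rw [← Polynomial.modByMonic_add_div P
      (Polynomial.X - Polynomial.C ((W : ℝ) + 1)), Polynomial.modByMonic_X_sub_C_eq_C_eval]
    simp [hV]
  rw [← sub_eq_zero, ← Finset.sum_sub_distrib, ← neg_eq_zero, ← h0, ← Finset.sum_neg_distrib]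
  refine Finset.sum_congr rfl fun j hj => ?_
  have hj' : (j : ℝ) ≤ W := by
    exact_mod_cast (Nat.lt_succ_iff.1 (Finset.mem_range.1 hj)).trans he
  have hne : (W : ℝ) + 1 - j ≠ 0 := by linarith
  rw [hPV j]
  field_simp
  ring

theorem sum_hahnPoly {W e : ℕ} (he : e ≤ W) :
    ∑ y ∈ Finset.range (W + 2), (hahnPoly W e).eval (y : ℝ) =
      ((W : ℝ) + 1) * (-1) ^ e * ((W + 2).ascFactorial (e + 1) : ℝ) /
        ((e + 1 : ℝ) * ((W + 1).descFactorial (e + 1) : ℝ)) ∧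
    (hahnPoly W e).eval ((W + 1 : ℕ) : ℝ) =
      ∑ y ∈ Finset.range (W + 2), (hahnPoly W e).eval (y : ℝ) -
        ((W : ℝ) + 1) * (-1) ^ e / (e + 1) := by
  set T : Polynomial ℝ := (ascPochhammer ℝ e).comp (Polynomial.X + Polynomial.C (2 : ℝ)) with hT
  have hTe : ∀ j : ℕ, T.eval (j : ℝ) = ((j + 2).ascFactorial e : ℝ) := fun j => by
    rw [hT, Nat.cast_ascFactorial]
    simp
  have hTm : T.Monic := (monic_ascPochhammer ℝ e).comp_X_add_C 2
  have hTd : T.natDegree = e := by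
    rw [hT, Polynomial.natDegree_comp, Polynomial.natDegree_X_add_C, ascPochhammer_natDegree,
      mul_one]
  have h1 := alternating_sum_choose_mul_eval_div T hTd.le he
  have h2 := alternating_sum_choose_mul_eval T hTd.le
  have hco : T.coeff e = 1 := by rw [← hTd]; exact hTm
  rw [hco, mul_one] at h2
  have hW1 : ((W : ℝ) + 1) = ((W + 1 : ℕ) : ℝ) := by push_cast; rfl
  have hA : ((W + 2).ascFactorial (e + 1) : ℝ) = ((W : ℝ) + 2) * T.eval ((W : ℝ) + 1) := by
    rw [hW1, hTe, Nat.ascFactorial_succ, ← Nat.succ_ascFactorial]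
    push_cast
    rfl
  have p2 : ((e + 1).factorial : ℝ) = (e + 1) * (e.factorial : ℝ) := by
    rw [Nat.factorial_succ]; push_cast; ring
  have p3 : (e.factorial : ℝ) ≠ 0 := by positivity
  have p4 : (e : ℝ) + 1 ≠ 0 := by positivity
  have p5 : ((W + 1).descFactorial (e + 1) : ℝ) ≠ 0 := by
    have := Nat.descFactorial_pos (n := W + 1) (k := e + 1)
    exact_mod_cast (this.2 (by omega)).ne'
  have hsum : ∑ y ∈ Finset.range (W + 2), (hahnPoly W e).eval (y : ℝ) =
      ((W + 1 : ℝ) * (W + 2) / ((e + 1).factorial : ℝ)) *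
        ∑ j ∈ Finset.range (e + 1), (-1 : ℝ) ^ j * (e.choose j : ℝ) *
          (T.eval (j : ℝ) / ((W : ℝ) + 1 - j)) := by
    have := sum_choose_mul_hahnPoly (W := W) (e := e) 0
    simp only [Nat.choose_zero_right, Nat.cast_one, one_mul, zero_add] at this
    rw [this, Finset.mul_sum]
    refine Finset.sum_congr rfl fun j hj => ?_
    rw [(hahnCoeff_mul_choose_succ (Nat.lt_succ_iff.1 (Finset.mem_range.1 hj)) he).1, hTe]
  refine ⟨?_, ?_⟩
  · rw [hsum, h1, hA, p2]
    field_simp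
  -- In the difference of the two sums the pole cancels termwise, leaving the monic `T` of degree
  -- `e`, whose alternating sum is `(-1)^e e!`.
  · have : ((W : ℝ) + 1) * (-1) ^ e / (e + 1) =
        ((W + 1 : ℝ) / ((e + 1).factorial : ℝ)) * ((-1) ^ e * (e.factorial : ℝ)) := by
      rw [p2]; field_simp
    rw [this, ← h2, hsum, hahnPoly_eval, Finset.mul_sum, Finset.mul_sum,
      ← Finset.sum_sub_distrib]
    refine Finset.sum_congr rfl fun j hj => ?_
    have hj1 := Nat.lt_succ_iff.1 (Finset.mem_range.1 hj)
    have hj' : (j : ℝ) ≤ W := by exact_mod_cast hj1.trans he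
    have hne : (W : ℝ) + 1 - j ≠ 0 := by linarith
    rw [(hahnCoeff_mul_choose_succ hj1 he).2, hTe]
    have p6 : ((e + 1).factorial : ℝ) ≠ 0 := by positivity
    field_simp
    ring

/-- Expand one factor in the basis `(W+1-y).choose k`: orthogonality removes all `k ≥ 1`, and the
constant term is the value at `y = W + 1`. -/
theorem sum_hahnPoly_sq {W e : ℕ} (he : e ≤ W) :
    ∑ y ∈ Finset.range (W + 2), (hahnPoly W e).eval (y : ℝ) ^ 2 =
      (hahnPoly W e).eval ((W + 1 : ℕ) : ℝ) *
        ∑ y ∈ Finset.range (W + 2), (hahnPoly W e).eval (y : ℝ) := by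
  set Q := (hahnPoly W e).comp (Polynomial.C ((W : ℝ) + 1) - Polynomial.X) with hQ
  have hdeg : Q.natDegree ≤ e := by
    have h2 : (Polynomial.C ((W : ℝ) + 1) - Polynomial.X).natDegree ≤ 1 := by
      refine (Polynomial.natDegree_sub_le _ _).trans ?_
      rw [Polynomial.natDegree_C, Polynomial.natDegree_X]; simp
    refine Polynomial.natDegree_comp_le.trans ?_
    simpa using Nat.mul_le_mul (natDegree_hahnPoly_le W e) h2
  obtain ⟨a, ha0, ha⟩ := eval_eq_sum_choose_mul Q hdeg
  have hQy : ∀ y ∈ Finset.range (W + 2), (hahnPoly W e).eval (y : ℝ) =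
      ∑ k ∈ Finset.range (e + 1), a k * ((W + 1 - y).choose k : ℝ) := by
    intro y hy
    have hy' : y ≤ W + 1 := Nat.lt_succ_iff.1 (Finset.mem_range.1 hy)
    rw [← ha, hQ, Nat.cast_sub hy']
    simp
  have h1 : ∀ y ∈ Finset.range (W + 2), (hahnPoly W e).eval (y : ℝ) ^ 2 =
      ∑ k ∈ Finset.range (e + 1), a k * (((W + 1 - y).choose k : ℝ) *
        (hahnPoly W e).eval (y : ℝ)) := by
    intro y hy
    rw [sq]
    nth_rw 1 [hQy y hy]
    rw [Finset.sum_mul]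
    exact Finset.sum_congr rfl fun _ _ => by ring
  rw [Finset.sum_congr rfl h1, Finset.sum_comm, Finset.sum_range_succ', Finset.sum_eq_zero]
  · have : a 0 = (hahnPoly W e).eval ((W + 1 : ℕ) : ℝ) := by
      rw [ha0, hQ]; simp
    simp [← Finset.mul_sum, this]
  · intro i hi
    rw [← Finset.mul_sum, hahnPoly_orthogonal he (Finset.mem_range.1 hi), mul_zero]

/-- With `P` the Hahn polynomial for `W = N - 1`, the witness is `P(N - x) / P(N)`. Its square sum
is `∑ P / P(N) = U / (U - D)`, where `D` and `U` are the falling and rising factorials in the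
hypothesis. -/
theorem exists_poly_sum_sq_lt {N e : ℕ} (he : e < N)
    (hA : ((N.descFactorial (e + 1) : ℝ)) < (1 - 1 / Real.sqrt 2) * ((N + 1).ascFactorial (e + 1) : ℝ)) :
    ∃ G : Polynomial ℝ, G.natDegree ≤ e ∧ G.eval 0 = 1 ∧
      ∑ x ∈ Finset.range (N + 1), G.eval (x : ℝ) ^ 2 < Real.sqrt 2 := by
  obtain ⟨W, rfl⟩ : ∃ W, N = W + 1 := ⟨N - 1, by omega⟩
  have heW : e ≤ W := by omega
  obtain ⟨hS, hv⟩ := sum_hahnPoly heW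
  have hsq := sum_hahnPoly_sq heW
  set S := ∑ y ∈ Finset.range (W + 2), (hahnPoly W e).eval (y : ℝ) with hSdef
  set v := (hahnPoly W e).eval ((W + 1 : ℕ) : ℝ) with hvdef
  set D : ℝ := ((W + 1).descFactorial (e + 1) : ℝ)
  set U : ℝ := ((W + 1 + 1).ascFactorial (e + 1) : ℝ)
  have hD : 0 < D := by
    have := Nat.descFactorial_pos (n := W + 1) (k := e + 1)
    exact Nat.cast_pos.2 (this.2 (by omega))
  have hs2 : 1 < Real.sqrt 2 := by
    rw [Real.lt_sqrt] <;> norm_num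
  have hs2' : (Real.sqrt 2) ^ 2 = 2 := Real.sq_sqrt (by norm_num)
  have hDU : D * Real.sqrt 2 < (Real.sqrt 2 - 1) * U := by
    have : (1 - 1 / Real.sqrt 2) * U * Real.sqrt 2 = (Real.sqrt 2 - 1) * U := by
      field_simp
    rw [← this]
    exact mul_lt_mul_of_pos_right hA (by linarith)
  have hUpos : 0 < U := by
    by_contra h
    nlinarith
  have hDltU : D < U := by nlinarith
  set K : ℝ := ((W : ℝ) + 1) * (-1) ^ e / ((e + 1 : ℝ) * D) with hK
  have hKne : K ≠ 0 := by
    rw [hK]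
    have : ((-1 : ℝ) ^ e) ≠ 0 := by simp
    positivity
  have hSK : S = K * U := by rw [hS, hK]; ring
  have hvK : v = K * (U - D) := by
    rw [hv, hSK, hK]
    field_simp
  have hUD : U - D ≠ 0 := by linarith
  have hvne : v ≠ 0 := by rw [hvK]; exact mul_ne_zero hKne hUD
  refine ⟨Polynomial.C v⁻¹ * (hahnPoly W e).comp (Polynomial.C ((W : ℝ) + 1) - Polynomial.X),
    ?_, ?_, ?_⟩
  · have h2 : (Polynomial.C ((W : ℝ) + 1) - Polynomial.X).natDegree ≤ 1 := by
      refine (Polynomial.natDegree_sub_le _ _).trans ?_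
      rw [Polynomial.natDegree_C, Polynomial.natDegree_X]; simp
    refine (Polynomial.natDegree_C_mul_le _ _).trans (Polynomial.natDegree_comp_le.trans ?_)
    simpa using Nat.mul_le_mul (natDegree_hahnPoly_le W e) h2
  · have : v = (hahnPoly W e).eval ((W : ℝ) + 1) := by rw [hvdef]; push_cast; rfl
    simp [← this, hvne]
  · have hre : ∑ x ∈ Finset.range (W + 1 + 1), (Polynomial.C v⁻¹ *
        (hahnPoly W e).comp (Polynomial.C ((W : ℝ) + 1) - Polynomial.X)).eval (x : ℝ) ^ 2 =
        v⁻¹ ^ 2 * ∑ y ∈ Finset.range (W + 2), (hahnPoly W e).eval (y : ℝ) ^ 2 := by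
      rw [← Finset.sum_range_reflect (fun y : ℕ => (hahnPoly W e).eval (y : ℝ) ^ 2),
        Finset.mul_sum]
      refine Finset.sum_congr rfl fun y hy => ?_
      have hy' : y ≤ W + 1 := Nat.lt_succ_iff.1 (Finset.mem_range.1 hy)
      rw [show W + 2 - 1 - y = W + 1 - y by omega, Nat.cast_sub hy']
      simp [mul_pow]
    have hval : v⁻¹ ^ 2 * (v * S) = U / (U - D) := by
      rw [hSK, hvK]
      field_simp
    rw [hre, hsq, hval, div_lt_iff₀ (by linarith)]
    linarith

/-- Each ratio `(N-k)/(N+1+k) = 1 - (2k+1)/(N+k+1)` is at most `exp(-(2k+1)/(N+e+1))`, and the odd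
numbers add up to a square. -/
theorem descFactorial_le_exp_mul_ascFactorial {N e : ℕ} (k : ℕ) (hk : k ≤ e + 1) :
    (N.descFactorial k : ℝ) ≤
      Real.exp (-((k : ℝ) ^ 2 / (N + e + 1))) * ((N + 1).ascFactorial k : ℝ) := by
  induction k with
  | zero => simp
  | succ k ih =>
    have ih := ih (by omega)
    rw [Nat.descFactorial_succ, Nat.ascFactorial_succ]
    have hke : (k : ℝ) ≤ e := by exact_mod_cast Nat.lt_succ_iff.1 hk
    have h1 : ((N - k : ℕ) : ℝ) ≤
        Real.exp (-((2 * k + 1 : ℝ) / (N + e + 1))) * ((N + 1 + k : ℕ) : ℝ) := by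
      rcases le_total N k with h | h
      · rw [Nat.sub_eq_zero_of_le h]; simp only [Nat.cast_zero]; positivity
      · rw [Nat.cast_sub h]
        have h2 := Real.add_one_le_exp (-((2 * k + 1 : ℝ) / (N + e + 1)))
        have h3 : (2 * k + 1 : ℝ) / (N + e + 1) ≤ (2 * k + 1 : ℝ) / (N + k + 1) := by gcongr
        have h4 : (2 * k + 1 : ℝ) / (N + k + 1) * (N + 1 + k) = 2 * k + 1 := by
          have : (N : ℝ) + k + 1 ≠ 0 := by positivity
          field_simp
          ring
        push_cast
        have h5 : (0 : ℝ) ≤ N + 1 + k := by positivity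
        nlinarith
    have h6 : Real.exp (-(((k + 1 : ℕ) : ℝ) ^ 2 / (N + e + 1))) =
        Real.exp (-((2 * k + 1 : ℝ) / (N + e + 1))) * Real.exp (-((k : ℝ) ^ 2 / (N + e + 1))) := by
      rw [← Real.exp_add]
      congr 1
      push_cast
      ring
    rw [h6]
    push_cast at h1 ⊢
    calc _ ≤ (Real.exp (-((2 * k + 1 : ℝ) / (N + e + 1))) * ((N : ℝ) + 1 + k)) *
        (Real.exp (-((k : ℝ) ^ 2 / (N + e + 1))) * ((N + 1).ascFactorial k : ℝ)) := by gcongr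
      _ = _ := by ring

theorem exists_poly_sum_sq_lt_sqrt_two {N e : ℕ} (he : e < N)
    (h : 1.235 * ((N : ℝ) + e + 1) ≤ ((e : ℝ) + 1) ^ 2) :
    ∃ G : Polynomial ℝ, G.natDegree ≤ e ∧ G.eval 0 = 1 ∧
      ∑ x ∈ Finset.range (N + 1), G.eval (x : ℝ) ^ 2 < Real.sqrt 2 := by
  refine exists_poly_sum_sq_lt he ?_
  have h1 := descFactorial_le_exp_mul_ascFactorial (N := N) (e := e) (e + 1) le_rfl
  refine h1.trans_lt ?_
  have hpos : (0 : ℝ) < ((N + 1).ascFactorial (e + 1) : ℝ) :=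
    Nat.cast_pos.2 (Nat.ascFactorial_pos _ _)
  refine mul_lt_mul_of_pos_right ?_ hpos
  have h2 : (1.235 : ℝ) ≤ (((e + 1 : ℕ) : ℝ) ^ 2 / (N + e + 1)) := by
    rw [le_div_iff₀ (by positivity)]
    push_cast
    exact h
  -- The constant 1.235 slightly exceeds `-log(1 - 1/√2) ≈ 1.228`.
  have h3 : (3.43 : ℝ) ≤ Real.exp 1.235 := by
    rw [show (1.235 : ℝ) = 1 + 0.235 by norm_num, Real.exp_add]
    have a1 := Real.exp_one_gt_d9
    have a2 := Real.quadratic_le_exp_of_nonneg (x := 0.235) (by norm_num)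
    nlinarith
  calc Real.exp (-(((e + 1 : ℕ) : ℝ) ^ 2 / (N + e + 1))) ≤ Real.exp (-1.235) :=
        Real.exp_le_exp.2 (by linarith)
    _ ≤ 1 / 3.43 := by
        rw [Real.exp_neg, ← one_div]
        exact one_div_le_one_div_of_le (by norm_num) h3
    _ < 1 - 1 / Real.sqrt 2 := by
        have h4 : (1.4142 : ℝ) < Real.sqrt 2 := by
          rw [Real.lt_sqrt] <;> norm_num
        have h5 : 1 / Real.sqrt 2 < 1 / 1.4142 := one_div_lt_one_div_of_lt (by norm_num) h4
        have : (1 : ℝ) / 3.43 + 1 / 1.4142 < 1 := by norm_num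
        linarith

/-! ### Double counting over choices of rows or columns -/

section Decks

theorem card_orderEmb_superset {n k : ℕ} (V : Finset (Fin n)) (hV : V.card ≤ k) :
    (Finset.univ.filter fun R : Fin k ↪o Fin n =>
      V ⊆ Finset.univ.map R.toEmbedding).card = (n - V.card).choose (k - V.card) := by
  have hc : (Finset.univ \ V).card = n - V.card := by
    rw [Finset.card_sdiff_of_subset (Finset.subset_univ V), Finset.card_univ, Fintype.card_fin]
  rw [← hc, ← Finset.card_powersetCard]
  refine Finset.card_bij (fun R _ => Finset.univ.map R.toEmbedding \ V) ?_ ?_ ?_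
  · intro R hR
    rw [Finset.mem_filter] at hR
    rw [Finset.mem_powersetCard, Finset.card_sdiff_of_subset hR.2]
    exact ⟨Finset.sdiff_subset_sdiff (Finset.subset_univ _) le_rfl, by simp⟩
  · intro R hR R' hR' h
    rw [Finset.mem_filter] at hR hR'
    have h2 : Finset.univ.map R.toEmbedding = Finset.univ.map R'.toEmbedding := by
      rw [← Finset.sdiff_union_of_subset hR.2, ← Finset.sdiff_union_of_subset hR'.2]
      exact congrArg (· ∪ V) h
    have h3 : Set.range R = Set.range R' := by
      ext x
      have := congrArg (x ∈ ·) h2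
      simpa using this
    exact DFunLike.coe_injective ((StrictMono.range_inj R.strictMono R'.strictMono).1 h3)
  · intro T hT
    rw [Finset.mem_powersetCard] at hT
    have hdisj : Disjoint V T :=
      (Finset.disjoint_sdiff (s := V) (t := Finset.univ)).mono_right hT.1
    have hcard : (V ∪ T).card = k := by
      rw [Finset.card_union_of_disjoint hdisj, hT.2]; omega
    have himg : Finset.univ.map ((V ∪ T).orderEmbOfFin hcard).toEmbedding = V ∪ T := by
      ext x
      simp
    refine ⟨(V ∪ T).orderEmbOfFin hcard, ?_, ?_⟩
    · rw [Finset.mem_filter, himg]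
      exact ⟨Finset.mem_univ _, Finset.subset_union_left⟩
    · simp only [himg]
      rw [Finset.union_sdiff_left]
      exact Finset.sdiff_eq_self_of_disjoint hdisj.symm

theorem choose_card_inter {ι : Type*} [DecidableEq ι] (R X : Finset ι) (a : ℕ) :
    ((R ∩ X).card.choose a : ℝ) = ∑ T ∈ X.powersetCard a, if T ⊆ R then (1 : ℝ) else 0 := by
  rw [← Finset.card_powersetCard, ← Finset.sum_filter, Finset.sum_const, nsmul_eq_mul, mul_one]
  congr 2
  ext T
  simp only [Finset.mem_powersetCard, Finset.mem_filter, Finset.subset_inter_iff]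
  tauto

/-- The summand counts pairs `T ⊆ X`, `U ⊆ Y` of sizes `a`, `b` lying in the chosen index set. After
exchanging sums, each `Z ∪ T ∪ U` lies in equally many choices. -/
theorem sum_orderEmb_choose_mul_choose {n k : ℕ} {Z X Y : Finset (Fin n)} (hZX : Disjoint Z X)
    (hZY : Disjoint Z Y) (hXY : Disjoint X Y) {a b : ℕ} (h : Z.card + a + b ≤ k) :
    (∑ R : Fin k ↪o Fin n, if Z ⊆ Finset.univ.map R.toEmbedding then
      ((Finset.univ.map R.toEmbedding ∩ X).card.choose a : ℝ) *
        ((Finset.univ.map R.toEmbedding ∩ Y).card.choose b : ℝ) else 0) =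
      ((n - (Z.card + a + b)).choose (k - (Z.card + a + b)) : ℝ) *
        ((X.card.choose a : ℝ) * (Y.card.choose b : ℝ)) := by
  have h1 : ∀ R : Fin k ↪o Fin n, (if Z ⊆ Finset.univ.map R.toEmbedding then
      ((Finset.univ.map R.toEmbedding ∩ X).card.choose a : ℝ) *
        ((Finset.univ.map R.toEmbedding ∩ Y).card.choose b : ℝ) else 0) =
      ∑ T ∈ X.powersetCard a, ∑ U ∈ Y.powersetCard b,
        if Z ∪ T ∪ U ⊆ Finset.univ.map R.toEmbedding then (1 : ℝ) else 0 := by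
    intro R
    simp only [Finset.union_subset_iff]
    split_ifs with hZ
    · rw [choose_card_inter, choose_card_inter, Finset.sum_mul_sum]
      refine Finset.sum_congr rfl fun T _ => Finset.sum_congr rfl fun U _ => ?_
      simp only [hZ, true_and, ite_and, mul_ite, mul_one, mul_zero]
      split_ifs <;> rfl
    · simp [hZ]
  simp only [h1]
  rw [Finset.sum_comm]
  have h2 : ∀ T ∈ X.powersetCard a, (∑ R : Fin k ↪o Fin n, ∑ U ∈ Y.powersetCard b,
      if Z ∪ T ∪ U ⊆ Finset.univ.map R.toEmbedding then (1 : ℝ) else 0) =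
      (Y.card.choose b : ℝ) *
        ((n - (Z.card + a + b)).choose (k - (Z.card + a + b)) : ℝ) := by
    intro T hT
    rw [Finset.mem_powersetCard] at hT
    rw [Finset.sum_comm, ← Finset.card_powersetCard, ← nsmul_eq_mul, ← Finset.sum_const]
    refine Finset.sum_congr rfl fun U hU => ?_
    rw [Finset.mem_powersetCard] at hU
    have hc : (Z ∪ T ∪ U).card = Z.card + a + b := by
      rw [Finset.card_union_of_disjoint, Finset.card_union_of_disjoint (hZX.mono_right hT.1),
        hT.2, hU.2]
      exact Finset.disjoint_union_left.2 ⟨hZY.mono_right hU.1, hXY.mono hT.1 hU.1⟩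
    rw [← hc, ← card_orderEmb_superset _ (hc.trans_le h), ← Finset.sum_filter, Finset.sum_const,
      nsmul_eq_mul, mul_one]
  rw [Finset.sum_congr rfl h2, Finset.sum_const, Finset.card_powersetCard, nsmul_eq_mul]
  ring

theorem card_map_inter_Iio {n k : ℕ} (R : Fin k ↪o Fin n) (r : Fin k) :
    (Finset.univ.map R.toEmbedding ∩ Finset.Iio (R r)).card = (r : ℕ) := by
  have : Finset.univ.map R.toEmbedding ∩ Finset.Iio (R r) =
      (Finset.Iio r).map R.toEmbedding := by
    ext x
    simp only [Finset.mem_inter, Finset.mem_map, Finset.mem_univ, true_and, Finset.mem_Iio]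
    constructor
    · rintro ⟨⟨s, rfl⟩, h⟩
      exact ⟨s, R.lt_iff_lt.1 h, rfl⟩
    · rintro ⟨s, h, rfl⟩
      exact ⟨⟨s, rfl⟩, R.lt_iff_lt.2 h⟩
  rw [this, Finset.card_map, Fin.card_Iio]

theorem card_map_inter_Ioo {n k : ℕ} (R : Fin k ↪o Fin n) (r s : Fin k) :
    (Finset.univ.map R.toEmbedding ∩ Finset.Ioo (R r) (R s)).card = (s : ℕ) - r - 1 := by
  have : Finset.univ.map R.toEmbedding ∩ Finset.Ioo (R r) (R s) =
      (Finset.Ioo r s).map R.toEmbedding := by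
    ext x
    simp only [Finset.mem_inter, Finset.mem_map, Finset.mem_univ, true_and, Finset.mem_Ioo]
    constructor
    · rintro ⟨⟨t, rfl⟩, h⟩
      exact ⟨t, ⟨R.lt_iff_lt.1 h.1, R.lt_iff_lt.1 h.2⟩, rfl⟩
    · rintro ⟨t, h, rfl⟩
      exact ⟨⟨t, rfl⟩, R.lt_iff_lt.2 h.1, R.lt_iff_lt.2 h.2⟩
  rw [this, Finset.card_map, Fin.card_Ioo]

/-- The position `r` of a kept index is the number of kept indices below it, so binomial moments of
positions in the subsequence are multiples of those in the full sequence. -/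
theorem sum_orderEmb_apply_mul_choose {n k : ℕ} (φ : Fin n → ℝ) {a : ℕ} (h : a + 1 ≤ k) :
    ∑ R : Fin k ↪o Fin n, ∑ r, φ (R r) * ((r : ℕ).choose a : ℝ) =
      ((n - (a + 1)).choose (k - (a + 1)) : ℝ) * ∑ i, φ i * ((i : ℕ).choose a : ℝ) := by
  have h1 : ∀ R : Fin k ↪o Fin n, ∑ r, φ (R r) * ((r : ℕ).choose a : ℝ) =
      ∑ i, φ i * (if {i} ⊆ Finset.univ.map R.toEmbedding then
        ((Finset.univ.map R.toEmbedding ∩ Finset.Iio i).card.choose a : ℝ) *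
        ((Finset.univ.map R.toEmbedding ∩ ∅).card.choose 0 : ℝ) else 0) := by
    intro R
    simp only [Finset.singleton_subset_iff, mul_ite, mul_zero]
    rw [← Finset.sum_filter, Finset.filter_univ_mem, Finset.sum_map]
    refine Finset.sum_congr rfl fun r _ => ?_
    have := card_map_inter_Iio R r
    simp only [RelEmbedding.coe_toEmbedding]
    rw [this]
    simp
  simp only [h1]
  rw [Finset.sum_comm, Finset.mul_sum]
  refine Finset.sum_congr rfl fun i _ => ?_
  rw [← Finset.mul_sum, sum_orderEmb_choose_mul_choose (by simp) (by simp) (by simp)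
    (by simp; omega)]
  simp only [Finset.card_singleton, Finset.card_empty, Fin.card_Iio, add_zero,
    Nat.choose_zero_right, Nat.cast_one, mul_one, add_comm 1 a]
  ring

/-- The same for two kept indices `i < j`, with the disjoint intervals below `i` and strictly
between `i` and `j`; disjointness is why the gap `j - i - 1` is used instead of `j`. -/
theorem sum_orderEmb_apply_lt_mul_choose {n k : ℕ} (φ : Fin n → Fin n → ℝ) {a b : ℕ}
    (h : a + b + 2 ≤ k) :
    (∑ R : Fin k ↪o Fin n, ∑ r, ∑ s, if r < s then φ (R r) (R s) *
        (((r : ℕ).choose a : ℝ) * (((s : ℕ) - r - 1).choose b : ℝ)) else 0) =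
      ((n - (a + b + 2)).choose (k - (a + b + 2)) : ℝ) *
        ∑ i, ∑ j, if i < j then φ i j *
          (((i : ℕ).choose a : ℝ) * (((j : ℕ) - i - 1).choose b : ℝ)) else 0 := by
  have h1 : ∀ R : Fin k ↪o Fin n, (∑ r, ∑ s, if r < s then φ (R r) (R s) *
        (((r : ℕ).choose a : ℝ) * (((s : ℕ) - r - 1).choose b : ℝ)) else 0) =
      ∑ i, ∑ j, if i < j then φ i j *
        (if {i, j} ⊆ Finset.univ.map R.toEmbedding then
          ((Finset.univ.map R.toEmbedding ∩ Finset.Iio i).card.choose a : ℝ) *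
          ((Finset.univ.map R.toEmbedding ∩ Finset.Ioo i j).card.choose b : ℝ) else 0) else 0 := by
    intro R
    have h2 : ∀ i j : Fin n, (if i < j then φ i j *
        (if {i, j} ⊆ Finset.univ.map R.toEmbedding then
          ((Finset.univ.map R.toEmbedding ∩ Finset.Iio i).card.choose a : ℝ) *
          ((Finset.univ.map R.toEmbedding ∩ Finset.Ioo i j).card.choose b : ℝ) else 0) else 0) =
        if i ∈ Finset.univ.map R.toEmbedding then if j ∈ Finset.univ.map R.toEmbedding then
          (if i < j then φ i j *
            (((Finset.univ.map R.toEmbedding ∩ Finset.Iio i).card.choose a : ℝ) *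
          ((Finset.univ.map R.toEmbedding ∩ Finset.Ioo i j).card.choose b : ℝ)) else 0)
            else 0 else 0 := by
      intro i j
      simp only [Finset.insert_subset_iff, Finset.singleton_subset_iff]
      split_ifs <;> simp_all
    simp only [h2]
    have h3 : ∀ i, (∑ j, if i ∈ Finset.univ.map R.toEmbedding then
        if j ∈ Finset.univ.map R.toEmbedding then
          (if i < j then φ i j *
            (((Finset.univ.map R.toEmbedding ∩ Finset.Iio i).card.choose a : ℝ) *
          ((Finset.univ.map R.toEmbedding ∩ Finset.Ioo i j).card.choose b : ℝ)) else 0)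
            else 0 else 0) = if i ∈ Finset.univ.map R.toEmbedding then
        ∑ s, (if i < R s then φ i (R s) *
            (((Finset.univ.map R.toEmbedding ∩ Finset.Iio i).card.choose a : ℝ) *
          ((Finset.univ.map R.toEmbedding ∩ Finset.Ioo i (R s)).card.choose b : ℝ)) else 0)
            else 0 := by
      intro i
      split_ifs
      · rw [← Finset.sum_filter, Finset.filter_univ_mem, Finset.sum_map]
        rfl
      · simp
    simp only [h3]
    rw [← Finset.sum_filter, Finset.filter_univ_mem, Finset.sum_map]
    refine Finset.sum_congr rfl fun r _ => Finset.sum_congr rfl fun s _ => ?_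
    have e1 := card_map_inter_Iio R r
    have e2 := card_map_inter_Ioo R r s
    simp only [RelEmbedding.coe_toEmbedding, OrderEmbedding.lt_iff_lt]
    rw [e1, e2]
  simp only [h1]
  rw [Finset.sum_comm, Finset.mul_sum]
  refine Finset.sum_congr rfl fun i _ => ?_
  rw [Finset.sum_comm, Finset.mul_sum]
  refine Finset.sum_congr rfl fun j _ => ?_
  split_ifs with hij
  · have hcard : ({i, j} : Finset (Fin n)).card = 2 := Finset.card_pair hij.ne
    rw [← Finset.mul_sum, sum_orderEmb_choose_mul_choose, hcard, Fin.card_Iio, Fin.card_Ioo,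
      show 2 + a + b = a + b + 2 by ring]
    · ring
    · simp [Finset.disjoint_left, hij.le]
    · simp [Finset.disjoint_left]
    · rw [Finset.disjoint_left]
      intro x hx hx'
      exact absurd (Finset.mem_Iio.1 hx) (not_lt.2 (Finset.mem_Ioo.1 hx').1.le)
    · omega
  · simp

end Decks

/-! ### From vanishing binomial moments to vanishing on polynomials -/

theorem sum_mul_eval_mul_eval_eq_zero {ι : Type*} {s : Finset ι} {α : ι → ℝ} {u v : ι → ℕ} {d : ℕ}
    (h : ∀ a b, a + b ≤ d →
      ∑ i ∈ s, α i * (((u i).choose a : ℝ) * ((v i).choose b : ℝ)) = 0)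
    {P Q : Polynomial ℝ} (hPQ : P.natDegree + Q.natDegree ≤ d) :
    ∑ i ∈ s, α i * (P.eval (u i : ℝ) * Q.eval (v i : ℝ)) = 0 := by
  obtain ⟨f, -, hf⟩ := eval_eq_sum_choose_mul P le_rfl
  obtain ⟨g, -, hg⟩ := eval_eq_sum_choose_mul Q le_rfl
  simp only [hf, hg, Finset.sum_mul_sum]
  simp only [Finset.mul_sum]
  rw [Finset.sum_comm]
  refine Finset.sum_eq_zero fun a ha => ?_
  rw [Finset.sum_comm]
  refine Finset.sum_eq_zero fun b hb => ?_
  rw [Finset.mem_range] at ha hb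
  have := h a b (by omega)
  calc _ = f a * g b * ∑ i ∈ s, α i * (((u i).choose a : ℝ) * ((v i).choose b : ℝ)) := by
        rw [Finset.mul_sum]
        exact Finset.sum_congr rfl fun i _ => by ring
    _ = 0 := by rw [this, mul_zero]

/-- An affine change of variables does not raise total degree. This lets moments in `(i, j - i - 1)`
serve for polynomials in the one-based `(i, j)`. -/
theorem sum_mul_mvPolynomial_eval_eq_zero {ι : Type*} {s : Finset ι} {α : ι → ℝ} {u v : ι → ℕ}
    {d : ℕ} (h : ∀ a b, a + b ≤ d →
      ∑ i ∈ s, α i * (((u i).choose a : ℝ) * ((v i).choose b : ℝ)) = 0)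
    {L₀ M₀ L₁ M₁ : Polynomial ℝ} (hL₀ : L₀.natDegree ≤ 1) (hM₀ : M₀.natDegree ≤ 1)
    (hL₁ : L₁.natDegree ≤ 1) (hM₁ : M₁.natDegree ≤ 1)
    {p : MvPolynomial (Fin 2) ℝ} (hp : p.totalDegree ≤ d) {x y : ι → ℝ}
    (hx : ∀ i ∈ s, x i = L₀.eval (u i : ℝ) + M₀.eval (v i : ℝ))
    (hy : ∀ i ∈ s, y i = L₁.eval (u i : ℝ) + M₁.eval (v i : ℝ)) :
    ∑ i ∈ s, α i * MvPolynomial.eval ![x i, y i] p = 0 := by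
  simp only [MvPolynomial.eval_eq', Fin.prod_univ_two, Matrix.cons_val_zero, Matrix.cons_val_one,
    Finset.mul_sum]
  rw [Finset.sum_comm]
  refine Finset.sum_eq_zero fun m hm => ?_
  have hdeg : m 0 + m 1 ≤ d := by
    have := MvPolynomial.le_totalDegree hm
    rw [Finsupp.sum_fintype _ _ (fun _ => rfl), Fin.sum_univ_two] at this
    exact this.trans hp
  have key : ∀ i ∈ s, α i * (MvPolynomial.coeff m p * (x i ^ m 0 * y i ^ m 1)) =
      ∑ c ∈ Finset.range (m 0 + 1), ∑ c' ∈ Finset.range (m 1 + 1),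
        MvPolynomial.coeff m p * (((m 0).choose c : ℝ) * ((m 1).choose c' : ℝ)) *
          (α i * ((L₀ ^ c * L₁ ^ c').eval (u i : ℝ) *
            (M₀ ^ (m 0 - c) * M₁ ^ (m 1 - c')).eval (v i : ℝ))) := by
    intro i hi
    rw [hx i hi, hy i hi, add_pow, add_pow, Finset.sum_mul_sum, Finset.mul_sum, Finset.mul_sum]
    refine Finset.sum_congr rfl fun c _ => ?_
    rw [Finset.mul_sum, Finset.mul_sum]
    refine Finset.sum_congr rfl fun c' _ => ?_
    simp only [Polynomial.eval_mul, Polynomial.eval_pow]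
    ring
  rw [Finset.sum_congr rfl key, Finset.sum_comm]
  refine Finset.sum_eq_zero fun c hc => ?_
  rw [Finset.sum_comm]
  refine Finset.sum_eq_zero fun c' hc' => ?_
  rw [Finset.mem_range] at hc hc'
  rw [← Finset.mul_sum, sum_mul_eval_mul_eval_eq_zero h, mul_zero]
  have hpow : ∀ (q : Polynomial ℝ) (k : ℕ), q.natDegree ≤ 1 → (q ^ k).natDegree ≤ k :=
    fun q k hq => Polynomial.natDegree_pow_le.trans (by nlinarith)
  have h1 := (Polynomial.natDegree_mul_le (p := L₀ ^ c) (q := L₁ ^ c')).trans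
    (Nat.add_le_add (hpow _ _ hL₀) (hpow _ _ hL₁))
  have h2 := (Polynomial.natDegree_mul_le (p := M₀ ^ (m 0 - c)) (q := M₁ ^ (m 1 - c'))).trans
    (Nat.add_le_add (hpow _ _ hM₀) (hpow _ _ hM₁))
  omega

/-! ### Decks determine moments, and peak polynomials determine the matrix -/

section Decks

variable {n k : ℕ} {A B : BinMatrix n}

/-- The entrywise difference of two binary matrices, with real entries. -/
def binDiff (A B : BinMatrix n) (i j : Fin n) : ℝ := ((A i j).val : ℝ) - ((B i j).val : ℝ)

theorem sum_deck_eq (h : deck k A = deck k B) (F : BinMatrix k → ℝ) :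
    ∑ R : Fin k ↪o Fin n, ∑ C : Fin k ↪o Fin n, F (A.submatrix R C) =
      ∑ R : Fin k ↪o Fin n, ∑ C : Fin k ↪o Fin n, F (B.submatrix R C) := by
  have := congrArg (fun S => (S.map F).sum) h
  simp only [deck, Multiset.map_map] at this
  rw [← Fintype.sum_prod_type', ← Fintype.sum_prod_type']
  exact this

theorem sum_principalDeck_eq (h : principalDeck k A = principalDeck k B) (F : BinMatrix k → ℝ) :
    ∑ R : Fin k ↪o Fin n, F (A.submatrix R R) = ∑ R : Fin k ↪o Fin n, F (B.submatrix R R) := by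
  have := congrArg (fun S => (S.map F).sum) h
  simp only [principalDeck, Multiset.map_map] at this
  exact this

theorem deck_moment (h : deck k A = deck k B) (hk : k ≤ n) {a b : ℕ} (ha : a + 1 ≤ k)
    (hb : b + 1 ≤ k) :
    ∑ i, ∑ j, binDiff A B i j * (((i : ℕ).choose a : ℝ) * ((j : ℕ).choose b : ℝ)) = 0 := by
  have key : ∀ ψ : Fin n → Fin n → ℝ, ∑ R : Fin k ↪o Fin n, ∑ C : Fin k ↪o Fin n,
      ∑ r, ∑ s, ψ (R r) (C s) *
        (((r : ℕ).choose a : ℝ) * ((s : ℕ).choose b : ℝ)) =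
      ((n - (a + 1)).choose (k - (a + 1)) : ℝ) * ((n - (b + 1)).choose (k - (b + 1)) : ℝ) *
      ∑ i, ∑ j, ψ i j * (((i : ℕ).choose a : ℝ) * ((j : ℕ).choose b : ℝ)) := by
    intro ψ
    have h1 : ∀ R : Fin k ↪o Fin n, ∑ C : Fin k ↪o Fin n,
        ∑ r, ∑ s, ψ (R r) (C s) *
        (((r : ℕ).choose a : ℝ) * ((s : ℕ).choose b : ℝ)) =
        ∑ r, (fun i => ((n - (b + 1)).choose (k - (b + 1)) : ℝ) *
          ∑ j, ψ i j * ((j : ℕ).choose b : ℝ)) (R r) * ((r : ℕ).choose a : ℝ) := by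
      intro R
      rw [Finset.sum_comm]
      refine Finset.sum_congr rfl fun r _ => ?_
      simp only
      rw [← sum_orderEmb_apply_mul_choose (ψ (R r)) hb, Finset.sum_mul]
      refine Finset.sum_congr rfl fun C _ => ?_
      rw [Finset.sum_mul]
      refine Finset.sum_congr rfl fun s _ => ?_
      ring
    have h2 := sum_orderEmb_apply_mul_choose (k := k) (fun i =>
      ((n - (b + 1)).choose (k - (b + 1)) : ℝ) * ∑ j, ψ i j * ((j : ℕ).choose b : ℝ)) ha
    rw [Finset.sum_congr rfl fun R _ => h1 R, h2, mul_assoc,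
      Finset.mul_sum (a := ((n - (b + 1)).choose _ : ℝ))]
    congr 1
    refine Finset.sum_congr rfl fun i _ => ?_
    rw [mul_assoc, Finset.sum_mul]
    congr 1
    exact Finset.sum_congr rfl fun j _ => by ring
  have h2 := sum_deck_eq h fun M => ∑ r, ∑ s, ((M r s).val : ℝ) *
        (((r : ℕ).choose a : ℝ) * ((s : ℕ).choose b : ℝ))
  simp only [Matrix.submatrix_apply] at h2
  rw [key fun i j => ((A i j).val : ℝ), key fun i j => ((B i j).val : ℝ)] at h2
  -- Here `k ≤ n` is needed: otherwise the multiplicity could be zero and the deck carry no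
  -- information.
  have c1 : ((n - (a + 1)).choose (k - (a + 1)) : ℝ) ≠ 0 :=
    Nat.cast_ne_zero.2 (Nat.choose_pos (by omega)).ne'
  have c2 : ((n - (b + 1)).choose (k - (b + 1)) : ℝ) ≠ 0 :=
    Nat.cast_ne_zero.2 (Nat.choose_pos (by omega)).ne'
  have h3 := mul_left_cancel₀ (mul_ne_zero c1 c2) h2
  simp only [binDiff, sub_mul, Finset.sum_sub_distrib]
  exact sub_eq_zero.2 h3

theorem principalDeck_moment_diag (h : principalDeck k A = principalDeck k B) (hk : k ≤ n)
    {a : ℕ} (ha : a + 1 ≤ k) : ∑ i, binDiff A B i i * ((i : ℕ).choose a : ℝ) = 0 := by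
  have h2 := sum_principalDeck_eq h fun M => ∑ r, ((M r r).val : ℝ) * ((r : ℕ).choose a : ℝ)
  have key : ∀ M : BinMatrix n, _ := fun M =>
    sum_orderEmb_apply_mul_choose (fun i => ((M i i).val : ℝ)) ha
  simp only [Matrix.submatrix_apply] at h2
  rw [key, key] at h2
  have c1 : ((n - (a + 1)).choose (k - (a + 1)) : ℝ) ≠ 0 :=
    Nat.cast_ne_zero.2 (Nat.choose_pos (by omega)).ne'
  have h3 := mul_left_cancel₀ c1 h2
  simp only [binDiff, sub_mul, Finset.sum_sub_distrib]
  exact sub_eq_zero.2 h3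

theorem principalDeck_moment_upper (h : principalDeck k A = principalDeck k B) (hk : k ≤ n)
    {a b : ℕ} (hab : a + b + 2 ≤ k) :
    (∑ i, ∑ j, if i < j then binDiff A B i j *
      (((i : ℕ).choose a : ℝ) * (((j : ℕ) - i - 1).choose b : ℝ)) else 0) = 0 := by
  have h2 := sum_principalDeck_eq h fun M => ∑ r, ∑ s, if r < s then ((M r s).val : ℝ) *
    (((r : ℕ).choose a : ℝ) * (((s : ℕ) - r - 1).choose b : ℝ)) else 0
  have key : ∀ M : BinMatrix n, _ := fun M =>
    sum_orderEmb_apply_lt_mul_choose (fun i j => ((M i j).val : ℝ)) hab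
  simp only [Matrix.submatrix_apply] at h2
  rw [key, key] at h2
  have c1 : ((n - (a + b + 2)).choose (k - (a + b + 2)) : ℝ) ≠ 0 :=
    Nat.cast_ne_zero.2 (Nat.choose_pos (by omega)).ne'
  have h3 := mul_left_cancel₀ c1 h2
  rw [← sub_eq_zero, ← Finset.sum_sub_distrib] at h3
  refine (Finset.sum_congr rfl fun i _ => ?_).trans h3
  rw [← Finset.sum_sub_distrib]
  refine Finset.sum_congr rfl fun j _ => ?_
  split_ifs
  · rw [binDiff, sub_mul]
  · simp

theorem principalDeck_transpose (h : principalDeck k A = principalDeck k B) :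
    principalDeck k A.transpose = principalDeck k B.transpose := by
  have key : ∀ M : BinMatrix n,
      principalDeck k M.transpose = (principalDeck k M).map Matrix.transpose := fun M => by
    simp only [principalDeck, Multiset.map_map]
    rfl
  rw [key, key, h]

theorem principalDeck_moment_lower (h : principalDeck k A = principalDeck k B) (hk : k ≤ n)
    {a b : ℕ} (hab : a + b + 2 ≤ k) :
    (∑ i, ∑ j, if j < i then binDiff A B i j *
      (((j : ℕ).choose a : ℝ) * (((i : ℕ) - j - 1).choose b : ℝ)) else 0) = 0 := by
  rw [Finset.sum_comm]
  exact principalDeck_moment_upper (principalDeck_transpose h) hk hab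

/-- The evaluation of a bivariate polynomial at the (one-based) position of a matrix entry. -/
noncomputable def evalPos (p : MvPolynomial (Fin 2) ℝ) (x : Fin n × Fin n) : ℝ :=
  MvPolynomial.eval ![((x.1 : ℕ) : ℝ) + 1, ((x.2 : ℕ) : ℝ) + 1] p

theorem sum_binDiff_mul_evalPos_of_deck (h : deck k A = deck k B) (hk : k ≤ n)
    {p : MvPolynomial (Fin 2) ℝ} (hp : p.totalDegree + 2 ≤ k) :
    ∑ x : Fin n × Fin n, binDiff A B x.1 x.2 * evalPos p x = 0 := by
  refine sum_mul_mvPolynomial_eval_eq_zero (d := k - 2) (u := fun x => (x.1 : ℕ))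
    (v := fun x => (x.2 : ℕ)) (L₀ := Polynomial.X + Polynomial.C 1) (M₀ := 0) (L₁ := 0)
    (M₁ := Polynomial.X + Polynomial.C 1) ?_ ?_ ?_ ?_ ?_ ?_ ?_ ?_
  · intro a b hab
    rw [Fintype.sum_prod_type]
    exact deck_moment h hk (by omega) (by omega)
  · exact (Polynomial.natDegree_X_add_C _).le
  · simp
  · simp
  · exact (Polynomial.natDegree_X_add_C _).le
  · omega
  · intro i _; simp
  · intro i _; simp

theorem sum_binDiff_mul_evalPos_of_principalDeck (h : principalDeck k A = principalDeck k B)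
    (hk : k ≤ n) {p : MvPolynomial (Fin 2) ℝ} (hp : p.totalDegree + 2 ≤ k) :
    ∑ x with x.1 = x.2, binDiff A B x.1 x.2 * evalPos p x = 0 ∧
    ∑ x with x.1 < x.2, binDiff A B x.1 x.2 * evalPos p x = 0 ∧
    ∑ x with x.2 < x.1, binDiff A B x.1 x.2 * evalPos p x = 0 := by
  have hX : (Polynomial.X + Polynomial.C (1 : ℝ)).natDegree ≤ 1 :=
    (Polynomial.natDegree_X_add_C _).le
  refine ⟨?_, ?_, ?_⟩
  · refine sum_mul_mvPolynomial_eval_eq_zero (d := k - 2) (u := fun x => (x.1 : ℕ))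
      (v := fun _ => 0) (L₀ := Polynomial.X + Polynomial.C 1) (M₀ := 0)
      (L₁ := Polynomial.X + Polynomial.C 1) (M₁ := 0) ?_ hX (by simp) hX (by simp) (by omega)
      ?_ ?_
    · intro a b hab
      have h1 := principalDeck_moment_diag h hk (a := a) (by omega)
      rw [Finset.sum_filter, Fintype.sum_prod_type]
      simp only [Finset.sum_ite_eq, Finset.mem_univ, if_true, ← mul_assoc]
      rw [← Finset.sum_mul, h1, zero_mul]
    · intro i _; simp
    · intro i hi
      have := (Finset.mem_filter.1 hi).2
      simp [this]
  -- With `u = i` and `v = j - i - 1` zero-based, the one-based column is `j + 1 = (u + 1) + (v +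
  -- 1)`.
  · refine sum_mul_mvPolynomial_eval_eq_zero (d := k - 2) (u := fun x => (x.1 : ℕ))
      (v := fun x => (x.2 : ℕ) - x.1 - 1) (L₀ := Polynomial.X + Polynomial.C 1) (M₀ := 0)
      (L₁ := Polynomial.X + Polynomial.C 1) (M₁ := Polynomial.X + Polynomial.C 1) ?_ hX (by simp)
      hX hX (by omega) ?_ ?_
    · intro a b hab
      rw [Finset.sum_filter, Fintype.sum_prod_type]
      exact principalDeck_moment_upper h hk (by omega)
    · intro i _; simp
    · intro i hi
      have := (Finset.mem_filter.1 hi).2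
      obtain ⟨c, hc⟩ := Nat.exists_eq_add_of_lt (Fin.lt_def.1 this)
      simp only [hc, Polynomial.eval_add, Polynomial.eval_X, Polynomial.eval_C]
      rw [show (i.1 : ℕ) + c + 1 - i.1 - 1 = c by omega]
      push_cast
      ring
  · refine sum_mul_mvPolynomial_eval_eq_zero (d := k - 2) (u := fun x => (x.2 : ℕ))
      (v := fun x => (x.1 : ℕ) - x.2 - 1) (L₀ := Polynomial.X + Polynomial.C 1)
      (M₀ := Polynomial.X + Polynomial.C 1)
      (L₁ := Polynomial.X + Polynomial.C 1) (M₁ := 0) ?_ hX hX hX (by simp) (by omega) ?_ ?_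
    · intro a b hab
      rw [Finset.sum_filter, Fintype.sum_prod_type]
      exact principalDeck_moment_lower h hk (by omega)
    · intro i hi
      have := (Finset.mem_filter.1 hi).2
      obtain ⟨c, hc⟩ := Nat.exists_eq_add_of_lt (Fin.lt_def.1 this)
      simp only [hc, Polynomial.eval_add, Polynomial.eval_X, Polynomial.eval_C]
      rw [show (i.2 : ℕ) + c + 1 - i.2 - 1 = c by omega]
      push_cast
      ring
    · intro i _; simp

/-- Every nonempty subset of `[n]²` admits a polynomial of total degree at most `k - 2` whose value
at some point of the set exceeds the sum of its absolute values at the other points. -/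
def HasPeakPoly (n k : ℕ) : Prop :=
  ∀ H : Finset (ℕ × ℕ), H ⊆ Finset.Icc 1 n ×ˢ Finset.Icc 1 n → H.Nonempty →
    ∃ p : MvPolynomial (Fin 2) ℝ, p.totalDegree + 2 ≤ k ∧
      ∃ h ∈ H, ∑ x ∈ H.erase h, |MvPolynomial.eval ![(x.1 : ℝ), (x.2 : ℝ)] p| <
        MvPolynomial.eval ![(h.1 : ℝ), (h.2 : ℝ)] p

theorem abs_binDiff_le (i j : Fin n) : |binDiff A B i j| ≤ 1 := by
  have h1 : ∀ x y : Fin 2, |((x.val : ℝ)) - (y.val : ℝ)| ≤ 1 := by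
    intro x y
    fin_cases x <;> fin_cases y <;> norm_num
  exact h1 _ _

theorem abs_binDiff_eq_one {i j : Fin n} (h : A i j ≠ B i j) : |binDiff A B i j| = 1 := by
  have h1 : ∀ x y : Fin 2, x ≠ y → |((x.val : ℝ)) - (y.val : ℝ)| = 1 := by
    intro x y
    fin_cases x <;> fin_cases y <;> norm_num
  exact h1 _ _ h

/-- Apply the peak property to the positions in `S` where the matrices differ. The coefficients
there are `±1`, so the value at the peak cannot be cancelled by the others. -/
theorem eq_on_of_sum_binDiff_eq_zero (hP : HasPeakPoly n k) (S : Finset (Fin n × Fin n))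
    (hS : ∀ p : MvPolynomial (Fin 2) ℝ, p.totalDegree + 2 ≤ k →
      ∑ x ∈ S, binDiff A B x.1 x.2 * evalPos p x = 0) :
    ∀ x ∈ S, A x.1 x.2 = B x.1 x.2 := by
  classical
  by_contra! hne
  set D := S.filter fun x => A x.1 x.2 ≠ B x.1 x.2 with hD
  let f : Fin n × Fin n ↪ ℕ × ℕ :=
    ⟨fun x => ((x.1 : ℕ) + 1, (x.2 : ℕ) + 1), fun x y hxy => by
      simp only [Prod.mk.injEq, Nat.add_right_cancel_iff] at hxy
      exact Prod.ext (Fin.ext hxy.1) (Fin.ext hxy.2)⟩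
  have hf : ∀ x, f x = ((x.1 : ℕ) + 1, (x.2 : ℕ) + 1) := fun _ => rfl
  have hsub : D.map f ⊆ Finset.Icc 1 n ×ˢ Finset.Icc 1 n := by
    intro z hz
    obtain ⟨x, -, rfl⟩ := Finset.mem_map.1 hz
    rw [hf, Finset.mem_product, Finset.mem_Icc, Finset.mem_Icc]
    have h1 := x.1.isLt
    have h2 := x.2.isLt
    dsimp only
    omega
  have hDne : (D.map f).Nonempty := by
    obtain ⟨x, hx, hx'⟩ := hne
    exact (Finset.map_nonempty).2 ⟨x, Finset.mem_filter.2 ⟨hx, hx'⟩⟩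
  obtain ⟨p, hp, h, hh, hlt⟩ := hP _ hsub hDne
  obtain ⟨x₀, hx₀, rfl⟩ := Finset.mem_map.1 hh
  have he : ∀ x, MvPolynomial.eval ![((f x).1 : ℝ), ((f x).2 : ℝ)] p = evalPos p x := by
    intro x; rw [hf]; simp [evalPos]
  rw [← Finset.map_erase, Finset.sum_map] at hlt
  simp only [he] at hlt
  have h0 : ∑ x ∈ D, binDiff A B x.1 x.2 * evalPos p x = 0 := by
    rw [← hS p hp]
    refine Finset.sum_subset (Finset.filter_subset _ _) fun x hx hxD => ?_
    have : A x.1 x.2 = B x.1 x.2 := by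
      by_contra hc
      exact hxD (Finset.mem_filter.2 ⟨hx, hc⟩)
    simp [binDiff, this]
  rw [← Finset.add_sum_erase _ _ hx₀] at h0
  have h1 := abs_binDiff_eq_one (A := A) (B := B) (Finset.mem_filter.1 hx₀).2
  have h2 : |evalPos p x₀| = |∑ x ∈ D.erase x₀, binDiff A B x.1 x.2 * evalPos p x| := by
    rw [← one_mul |evalPos p x₀|, ← h1, ← abs_mul, eq_neg_of_add_eq_zero_left h0, abs_neg]
  have h3 : |∑ x ∈ D.erase x₀, binDiff A B x.1 x.2 * evalPos p x| ≤
      ∑ x ∈ D.erase x₀, |evalPos p x| := by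
    refine (Finset.abs_sum_le_sum_abs _ _).trans (Finset.sum_le_sum fun x _ => ?_)
    rw [abs_mul]
    exact mul_le_of_le_one_left (abs_nonneg _) (abs_binDiff_le _ _)
  have h4 := le_abs_self (evalPos p x₀)
  linarith

theorem kappa₂_le_of_hasPeakPoly (hP : HasPeakPoly n k) (hk : k ≤ n) : kappa₂ n ≤ k := by
  refine (isLeast_kappa₂ n).2 fun A B h => ?_
  refine Matrix.ext fun i j => ?_
  exact eq_on_of_sum_binDiff_eq_zero hP Finset.univ
    (fun p hp => sum_binDiff_mul_evalPos_of_deck h hk hp) (i, j) (Finset.mem_univ _)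

theorem kappaP₂_le_of_hasPeakPoly (hP : HasPeakPoly n k) (hk : k ≤ n) : kappaP₂ n ≤ k := by
  refine (isLeast_kappaP₂ n).2 fun A B h => ?_
  refine Matrix.ext fun i j => ?_
  have key := fun (p : MvPolynomial (Fin 2) ℝ) (hp : p.totalDegree + 2 ≤ k) =>
    sum_binDiff_mul_evalPos_of_principalDeck h hk hp
  rcases lt_trichotomy i j with hij | hij | hij
  · exact eq_on_of_sum_binDiff_eq_zero hP _ (fun p hp => (key p hp).2.1) (i, j) (by simpa using hij)
  · exact eq_on_of_sum_binDiff_eq_zero hP _ (fun p hp => (key p hp).1) (i, j) (by simpa using hij)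
  · exact eq_on_of_sum_binDiff_eq_zero hP _ (fun p hp => (key p hp).2.2) (i, j) (by simpa using hij)

end Decks

/-! ### Peak polynomials from two linear forms with a common maximiser -/

theorem exists_mvPolynomial_eval_linear (G : Polynomial ℝ) (a b c : ℝ) :
    ∃ p : MvPolynomial (Fin 2) ℝ, p.totalDegree ≤ G.natDegree ∧
      ∀ x y : ℝ, MvPolynomial.eval ![x, y] p = G.eval (c - (a * x + b * y)) := by
  set ℓ : MvPolynomial (Fin 2) ℝ := MvPolynomial.C c -
    (MvPolynomial.C a * MvPolynomial.X 0 + MvPolynomial.C b * MvPolynomial.X 1) with hℓ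
  have hdeg : ℓ.totalDegree ≤ 1 := by
    have h1 : ∀ (r : ℝ) (i : Fin 2),
        (MvPolynomial.C r * MvPolynomial.X i : MvPolynomial (Fin 2) ℝ).totalDegree ≤ 1 := by
      intro r i
      refine (MvPolynomial.totalDegree_mul _ _).trans ?_
      rw [MvPolynomial.totalDegree_C, MvPolynomial.totalDegree_X]
    refine (MvPolynomial.totalDegree_sub _ _).trans (max_le (by simp) ?_)
    exact (MvPolynomial.totalDegree_add _ _).trans (max_le (h1 _ _) (h1 _ _))
  refine ⟨∑ i ∈ Finset.range (G.natDegree + 1), MvPolynomial.C (G.coeff i) * ℓ ^ i, ?_, ?_⟩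
  · refine MvPolynomial.totalDegree_finsetSum_le fun i hi => ?_
    refine (MvPolynomial.totalDegree_mul _ _).trans ?_
    rw [MvPolynomial.totalDegree_C, zero_add]
    refine (MvPolynomial.totalDegree_pow _ _).trans ?_
    rw [Finset.mem_range] at hi
    nlinarith
  · intro x y
    rw [Polynomial.eval_eq_sum_range, map_sum]
    refine Finset.sum_congr rfl fun i _ => ?_
    simp [hℓ]

/-- The linear form with weights `1 - t` and `t`. -/
def tiltForm (t : ℚ) (x : ℕ × ℕ) : ℚ := (1 - t) * x.1 + t * x.2

theorem tiltForm_ext {t t' : ℚ} (htt : t ≠ t') {x y : ℕ × ℕ} (h : tiltForm t x = tiltForm t y)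
    (h' : tiltForm t' x = tiltForm t' y) : x = y := by
  simp only [tiltForm] at h h'
  have h1 : (t - t') * (((x.2 : ℚ) - y.2) - ((x.1 : ℚ) - y.1)) = 0 := by linear_combination h - h'
  have h2 := (mul_eq_zero.1 h1).resolve_left (sub_ne_zero.2 htt)
  have h3 : (x.1 : ℚ) = y.1 := by linear_combination h - t * h2
  have h4 : (x.2 : ℚ) = y.2 := by linear_combination h2 + h3
  exact Prod.ext (by exact_mod_cast h3) (by exact_mod_cast h4)

theorem exists_nat_eq_den_mul_tiltForm_sub {t : ℚ} (h0 : 0 ≤ t) (h1 : t ≤ 1) {m n : ℕ}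
    (hden : t.den ≤ m) {h x : ℕ × ℕ} (hmax : tiltForm t x ≤ tiltForm t h) (hh1 : h.1 ≤ n)
    (hh2 : h.2 ≤ n) :
    ∃ u : ℕ, u ≤ m * n ∧ (u : ℚ) = t.den * (tiltForm t h - tiltForm t x) := by
  have hd : (t.den : ℚ) * t = t.num := by
    rw [mul_comm]; exact Rat.mul_den_eq_num t
  have hz : ((((t.den : ℤ) - t.num) * ((h.1 : ℤ) - x.1) + t.num * ((h.2 : ℤ) - x.2) : ℤ) : ℚ) =
      t.den * (tiltForm t h - tiltForm t x) := by
    push_cast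
    rw [← hd]
    simp only [tiltForm]
    ring
  have hpos : (0 : ℚ) ≤ t.den * (tiltForm t h - tiltForm t x) :=
    mul_nonneg (by positivity) (by linarith)
  rw [← hz] at hpos ⊢
  have hpos' := Int.cast_nonneg_iff.1 hpos
  obtain ⟨u, hu⟩ := Int.eq_ofNat_of_zero_le hpos'
  refine ⟨u, ?_, by rw [hu]; simp⟩
  have hq : (u : ℚ) ≤ (m : ℚ) * n := by
    have e1 : (u : ℚ) = t.den * (tiltForm t h - tiltForm t x) := by
      rw [← hz, hu]; simp
    rw [e1]
    have hx : 0 ≤ tiltForm t x := by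
      have : 0 ≤ 1 - t := by linarith
      unfold tiltForm; positivity
    have hhn : tiltForm t h ≤ n := by
      have e2 : (h.1 : ℚ) ≤ n := by exact_mod_cast hh1
      have e3 : (h.2 : ℚ) ≤ n := by exact_mod_cast hh2
      unfold tiltForm
      nlinarith
    have e4 : (t.den : ℚ) ≤ m := by exact_mod_cast hden
    calc (t.den : ℚ) * (tiltForm t h - tiltForm t x) ≤ t.den * n := by
          apply mul_le_mul_of_nonneg_left _ (by positivity); linarith
      _ ≤ m * n := by gcongr
  exact_mod_cast hq

theorem exists_peak_of_common_max {n m e : ℕ} {G : Polynomial ℝ} (hdeg : G.natDegree ≤ e)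
    (hG0 : G.eval 0 = 1)
    (hG : ∑ x ∈ Finset.range (m * n + 1), G.eval (x : ℝ) ^ 2 < Real.sqrt 2)
    {H : Finset (ℕ × ℕ)} (hH : H ⊆ Finset.Icc 1 n ×ˢ Finset.Icc 1 n) {h : ℕ × ℕ} (hh : h ∈ H)
    {t t' : ℚ} (htt : t ≠ t') (ht0 : 0 ≤ t) (ht1 : t ≤ 1) (htd : t.den ≤ m)
    (ht0' : 0 ≤ t') (ht1' : t' ≤ 1) (htd' : t'.den ≤ m)
    (hmax : ∀ x ∈ H, tiltForm t x ≤ tiltForm t h)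
    (hmax' : ∀ x ∈ H, tiltForm t' x ≤ tiltForm t' h) :
    ∃ p : MvPolynomial (Fin 2) ℝ, p.totalDegree ≤ 4 * e ∧
      ∑ x ∈ H.erase h, |MvPolynomial.eval ![(x.1 : ℝ), (x.2 : ℝ)] p| <
        MvPolynomial.eval ![(h.1 : ℝ), (h.2 : ℝ)] p := by
  have hhn := hH hh
  rw [Finset.mem_product, Finset.mem_Icc, Finset.mem_Icc] at hhn
  have key : ∀ s : ℚ, 0 ≤ s → s ≤ 1 → s.den ≤ m → (∀ x ∈ H, tiltForm s x ≤ tiltForm s h) →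
      ∃ (u : ℕ × ℕ → ℕ) (p : MvPolynomial (Fin 2) ℝ), p.totalDegree ≤ e ∧
        (∀ x ∈ H, u x ∈ Finset.range (m * n + 1) ∧
          (u x : ℚ) = s.den * (tiltForm s h - tiltForm s x)) ∧
        ∀ x ∈ H, MvPolynomial.eval ![(x.1 : ℝ), (x.2 : ℝ)] p = G.eval (u x : ℝ) := by
    intro s hs0 hs1 hsd hsmax
    have := fun x (hx : x ∈ H) => exists_nat_eq_den_mul_tiltForm_sub hs0 hs1 hsd (hsmax x hx)
      hhn.1.2 hhn.2.2
    choose! u hu1 hu2 using this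
    obtain ⟨p, hp, hpe⟩ := exists_mvPolynomial_eval_linear G (s.den * (1 - (s : ℝ)))
      (s.den * (s : ℝ)) (s.den * ((1 - (s : ℝ)) * h.1 + s * h.2))
    refine ⟨u, p, hp.trans hdeg, fun x hx =>
      ⟨Finset.mem_range.2 (Nat.lt_succ_of_le (hu1 x hx)), hu2 x hx⟩, fun x hx => ?_⟩
    rw [hpe]
    congr 1
    have := congrArg (Rat.cast : ℚ → ℝ) (hu2 x hx)
    simp only [tiltForm] at this
    push_cast at this
    rw [this]
    ring
  obtain ⟨u, p, hp, hu, hpe⟩ := key t ht0 ht1 htd hmax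
  obtain ⟨u', p', hp', hu', hpe'⟩ := key t' ht0' ht1' htd' hmax'
  refine ⟨p ^ 2 * p' ^ 2, ?_, ?_⟩
  · have h1 := MvPolynomial.totalDegree_mul (p ^ 2) (p' ^ 2)
    have h2 := MvPolynomial.totalDegree_pow p 2
    have h3 := MvPolynomial.totalDegree_pow p' 2
    omega
  have hval : ∀ x ∈ H, MvPolynomial.eval ![(x.1 : ℝ), (x.2 : ℝ)] (p ^ 2 * p' ^ 2) =
      G.eval (u x : ℝ) ^ 2 * G.eval (u' x : ℝ) ^ 2 := by
    intro x hx
    rw [map_mul, map_pow, map_pow, hpe x hx, hpe' x hx]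
  have hu0 : u h = 0 := by
    have := (hu h hh).2
    rw [sub_self, mul_zero] at this
    exact_mod_cast this
  have hu0' : u' h = 0 := by
    have := (hu' h hh).2
    rw [sub_self, mul_zero] at this
    exact_mod_cast this
  -- Injectivity lets the sum over `H` be bounded by a sum over the full grid, which factors into
  -- the square of a one-dimensional sum.
  have hinj : Set.InjOn (fun x => (u x, u' x)) (H : Set (ℕ × ℕ)) := by
    intro x hx y hy hxy
    simp only [Prod.mk.injEq] at hxy
    have e1 := (hu x hx).2
    have e2 := (hu y hy).2
    have e3 := (hu' x hx).2
    have e4 := (hu' y hy).2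
    rw [hxy.1, e2] at e1
    rw [hxy.2, e4] at e3
    have d1 : (t.den : ℚ) ≠ 0 := by exact_mod_cast t.den_nz
    have d2 : (t'.den : ℚ) ≠ 0 := by exact_mod_cast t'.den_nz
    have f1 := mul_left_cancel₀ d1 e1
    have f2 := mul_left_cancel₀ d2 e3
    exact tiltForm_ext htt (by linarith) (by linarith)
  have hsum : ∑ x ∈ H, G.eval (u x : ℝ) ^ 2 * G.eval (u' x : ℝ) ^ 2 < 2 := by
    calc ∑ x ∈ H, G.eval (u x : ℝ) ^ 2 * G.eval (u' x : ℝ) ^ 2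
        = ∑ z ∈ H.image (fun x => (u x, u' x)), G.eval (z.1 : ℝ) ^ 2 * G.eval (z.2 : ℝ) ^ 2 := by
          rw [Finset.sum_image hinj]
      _ ≤ ∑ z ∈ Finset.range (m * n + 1) ×ˢ Finset.range (m * n + 1),
            G.eval (z.1 : ℝ) ^ 2 * G.eval (z.2 : ℝ) ^ 2 := by
          refine Finset.sum_le_sum_of_subset_of_nonneg ?_ fun _ _ _ => by positivity
          intro z hz
          obtain ⟨x, hx, rfl⟩ := Finset.mem_image.1 hz
          exact Finset.mem_product.2 ⟨(hu x hx).1, (hu' x hx).1⟩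
      _ = (∑ x ∈ Finset.range (m * n + 1), G.eval (x : ℝ) ^ 2) ^ 2 := by
          rw [sq, Finset.sum_mul_sum, Finset.sum_product]
      _ < Real.sqrt 2 ^ 2 := by
          refine pow_lt_pow_left₀ hG (Finset.sum_nonneg fun _ _ => by positivity) (by norm_num)
      _ = 2 := Real.sq_sqrt (by norm_num)
  rw [← Finset.add_sum_erase _ _ hh, hu0, hu0'] at hsum
  rw [hval h hh, hu0, hu0']
  have habs : ∑ x ∈ H.erase h, |MvPolynomial.eval ![(x.1 : ℝ), (x.2 : ℝ)] (p ^ 2 * p' ^ 2)| =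
      ∑ x ∈ H.erase h, G.eval (u x : ℝ) ^ 2 * G.eval (u' x : ℝ) ^ 2 := by
    refine Finset.sum_congr rfl fun x hx => ?_
    rw [hval x (Finset.mem_of_mem_erase hx), abs_of_nonneg (by positivity)]
  rw [habs]
  simp only [Nat.cast_zero, hG0] at hsum ⊢
  linarith

/-! ### Farey fractions and a common maximiser -/

/-- The Farey fractions of order `m`. -/
def fareySet (m : ℕ) : Finset ℚ :=
  ((Finset.range (m + 1) ×ˢ Finset.Icc 1 m).image fun z => (z.1 : ℚ) / z.2).filter (· ≤ 1)

theorem mem_fareySet {m : ℕ} {t : ℚ} : t ∈ fareySet m ↔ 0 ≤ t ∧ t ≤ 1 ∧ t.den ≤ m := by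
  simp only [fareySet, Finset.mem_filter, Finset.mem_image, Finset.mem_product, Finset.mem_range,
    Finset.mem_Icc]
  constructor
  · rintro ⟨⟨⟨a, q⟩, ⟨ha, hq1, hqm⟩, rfl⟩, h1⟩
    refine ⟨by positivity, h1, ?_⟩
    have h2 := Rat.den_dvd (a : ℤ) (q : ℤ)
    rw [Rat.divInt_eq_div] at h2
    have h3 := Nat.le_of_dvd (by omega) (Int.natCast_dvd_natCast.1 h2)
    simp only [Int.cast_natCast] at h3
    exact h3.trans hqm
  · rintro ⟨h0, h1, hd⟩
    refine ⟨⟨(t.num.toNat, t.den), ⟨?_, t.den_pos, hd⟩, ?_⟩, h1⟩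
    · have := (Rat.num_le_denom_iff).2 h1
      have := t.den_pos
      omega
    · have h2 : ((t.num.toNat : ℤ) : ℚ) = t.num := by
        rw [Int.toNat_of_nonneg (Rat.num_nonneg.2 h0)]
      simp only [Int.cast_natCast] at h2
      rw [h2, Rat.num_div_den]

theorem exists_mul_card_le_of_gap {α : Type*} [LinearOrder α] (f : α → ℤ) (c : ℤ) (S : Finset α)
    (hgap : ∀ x ∈ S, ∀ y ∈ S, x < y → (∀ z ∈ S, ¬ (x < z ∧ z < y)) → c ≤ f y - f x)
    (hS : S.Nonempty) :
    ∃ x ∈ S, ∃ y ∈ S, (∀ z ∈ S, z ≤ y) ∧ ((S.card : ℤ) - 1) * c ≤ f y - f x := by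
  induction S using Finset.induction_on_max with
  | empty => exact absurd hS (by simp)
  | insert a s hmax ih =>
    have ha : a ∉ s := fun h => lt_irrefl _ (hmax a h)
    rcases s.eq_empty_or_nonempty with rfl | hs
    · exact ⟨a, by simp, a, by simp, by simp, by simp⟩
    · obtain ⟨x, hx, y, hy, hyz, hc⟩ := ih (fun x hx y hy hxy hz => hgap x
        (Finset.mem_insert_of_mem hx) y (Finset.mem_insert_of_mem hy) hxy fun z hz' hh => by
          rcases Finset.mem_insert.1 hz' with rfl | h
          · exact lt_asymm hh.2 (hmax y hy)
          · exact hz z h hh) hs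
      refine ⟨x, Finset.mem_insert_of_mem hx, a, Finset.mem_insert_self _ _, ?_, ?_⟩
      · intro z hz
        rcases Finset.mem_insert.1 hz with rfl | h
        · exact le_rfl
        · exact (hmax z h).le
      · have h1 := hgap y (Finset.mem_insert_of_mem hy) a (Finset.mem_insert_self _ _) (hmax y hy)
          fun z hz' hh => by
            rcases Finset.mem_insert.1 hz' with rfl | h
            · exact lt_irrefl _ hh.2
            · exact not_lt.2 (hyz z h) hh.1
        rw [Finset.card_insert_of_notMem ha]
        push_cast
        linarith

/-- The two strict inequalities say `tZ < X < t'Z` for the integers below, so `Z > 0` and `X / Z`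
lies strictly between neighbouring Farey fractions. Its denominator must exceed `m`, hence so must
`Z`. -/
theorem fareySet_gap {m : ℕ} {t t' : ℚ} (ht : t ∈ fareySet m) (ht' : t' ∈ fareySet m)
    (htt : t < t') (hcons : ∀ s ∈ fareySet m, ¬ (t < s ∧ s < t')) {h h' : ℕ × ℕ}
    (h1 : tiltForm t h' < tiltForm t h) (h2 : tiltForm t' h < tiltForm t' h') :
    (m : ℤ) + 1 ≤ ((h'.2 : ℤ) - h'.1) - ((h.2 : ℤ) - h.1) := by
  rw [mem_fareySet] at ht ht'
  set X : ℤ := (h.1 : ℤ) - h'.1 with hX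
  set Z : ℤ := ((h'.2 : ℤ) - h'.1) - ((h.2 : ℤ) - h.1) with hZ
  have hXq : (X : ℚ) = (h.1 : ℚ) - h'.1 := by rw [hX]; push_cast; rfl
  have hZq : (Z : ℚ) = ((h'.2 : ℚ) - h'.1) - ((h.2 : ℚ) - h.1) := by rw [hZ]; push_cast; rfl
  have e1 : t * Z < X := by
    rw [hXq, hZq]; unfold tiltForm at h1; linarith
  have e2 : (X : ℚ) < t' * Z := by
    rw [hXq, hZq]; unfold tiltForm at h2; linarith
  have hZpos : (0 : ℚ) < Z := by
    by_contra hc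
    nlinarith
  by_contra hlt
  have hZm : Z ≤ m := by linarith [not_le.1 hlt]
  have hZ0 : 0 < Z := by exact_mod_cast hZpos
  have s1 : t < (X : ℚ) / Z := by rwa [lt_div_iff₀ hZpos]
  have s2 : (X : ℚ) / Z < t' := by rwa [div_lt_iff₀ hZpos]
  refine hcons ((X : ℚ) / Z) (mem_fareySet.2 ⟨by linarith [ht.1], by linarith [ht'.2.1], ?_⟩)
    ⟨s1, s2⟩
  have h3 := Rat.den_dvd X Z
  rw [Rat.divInt_eq_div] at h3
  have h4 := Int.le_of_dvd hZ0 h3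
  exact_mod_cast h4.trans hZm

theorem exists_common_max {n m : ℕ} (hm : 2 * (n : ℤ) < (((fareySet m).card : ℤ) - 1) * (m + 1))
    {H : Finset (ℕ × ℕ)} (hH : H ⊆ Finset.Icc 1 n ×ˢ Finset.Icc 1 n) (hne : H.Nonempty) :
    ∃ t ∈ fareySet m, ∃ t' ∈ fareySet m, t ≠ t' ∧ ∃ h ∈ H,
      (∀ x ∈ H, tiltForm t x ≤ tiltForm t h) ∧ ∀ x ∈ H, tiltForm t' x ≤ tiltForm t' h := by
  by_contra! hcon
  have hex : ∀ t : ℚ, ∃ h ∈ H, ∀ x ∈ H, tiltForm t x ≤ tiltForm t h := fun t =>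
    Finset.exists_max_image H (tiltForm t) hne
  choose h hhH hmax using hex
  -- A tie would make the maximiser for `t'` also a maximiser for `t`.
  have hstrict : ∀ t ∈ fareySet m, ∀ t' ∈ fareySet m, t ≠ t' →
      tiltForm t (h t') < tiltForm t (h t) := by
    intro t ht t' ht' htt
    obtain ⟨x, hx, hlt⟩ := hcon t' ht' t ht htt.symm (h t') (hhH t') (hmax t')
    exact hlt.trans_le (hmax t x hx)
  have hSne : (fareySet m).Nonempty := by
    rw [Finset.nonempty_iff_ne_empty]
    intro h0
    rw [h0, Finset.card_empty] at hm
    push_cast at hm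
    nlinarith
  obtain ⟨x, -, y, -, -, hc⟩ := exists_mul_card_le_of_gap
    (fun t => ((h t).2 : ℤ) - (h t).1) ((m : ℤ) + 1) (fareySet m)
    (fun t ht t' ht' htt hcons => fareySet_gap ht ht' htt hcons
      (hstrict t ht t' ht' htt.ne) (hstrict t' ht' t ht htt.ne')) hSne
  have hx := hH (hhH x)
  have hy := hH (hhH y)
  rw [Finset.mem_product, Finset.mem_Icc, Finset.mem_Icc] at hx hy
  omega

/-! ### A lower bound for the number of Farey fractions -/

/-- Coprime pairs give distinct reduced fractions in `(0,1]`; the fraction 0 makes the inequality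
strict. -/
theorem card_coprime_lt_card_fareySet {m : ℕ} (hm : 0 < m) :
    ((Finset.Ioc 0 m ×ˢ Finset.Ioc 0 m).filter fun z => z.1 ≤ z.2 ∧ z.1.Coprime z.2).card <
      (fareySet m).card := by
  set C := (Finset.Ioc 0 m ×ˢ Finset.Ioc 0 m).filter fun z => z.1 ≤ z.2 ∧ z.1.Coprime z.2 with hC
  have hinj : Set.InjOn (fun z : ℕ × ℕ => (z.1 : ℚ) / z.2) (C : Set (ℕ × ℕ)) := by
    rintro ⟨a, b⟩ h ⟨c, d⟩ h' heq
    simp only [hC, Finset.coe_filter, Finset.mem_product, Finset.mem_Ioc, Set.mem_ofPred_eq] at h h'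
    simp only at heq
    have := Rat.div_int_inj (a := (a : ℤ)) (b := b) (c := c) (d := d) (by omega) (by omega)
      (by simpa using h.2.2) (by simpa using h'.2.2) (by simpa using heq)
    exact Prod.ext (by exact_mod_cast this.1) (by exact_mod_cast this.2)
  have h0 : (0 : ℚ) ∈ fareySet m := mem_fareySet.2 ⟨le_rfl, zero_le_one, by simpa using Nat.succ_le_of_lt hm⟩
  rw [← Finset.card_image_of_injOn hinj, ← Finset.card_erase_add_one h0, Nat.lt_succ_iff]
  refine Finset.card_le_card fun t ht => ?_
  obtain ⟨⟨a, b⟩, hz, rfl⟩ := Finset.mem_image.1 ht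
  simp only [hC, Finset.mem_filter, Finset.mem_product, Finset.mem_Ioc] at hz
  have ha : (0 : ℚ) < a := by exact_mod_cast hz.1.1.1
  have hb : (0 : ℚ) < b := by exact_mod_cast hz.1.2.1
  have hab : (a : ℚ) ≤ b := by exact_mod_cast hz.2.1
  refine Finset.mem_erase.2 ⟨by positivity, Finset.mem_filter.2 ⟨Finset.mem_image.2
    ⟨(a, b), ?_, rfl⟩, (div_le_one hb).2 hab⟩⟩
  simp only [Finset.mem_product, Finset.mem_range, Finset.mem_Icc]
  omega

theorem card_coprime_le_two_mul (m : ℕ) :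
    ((Finset.Ioc 0 m ×ˢ Finset.Ioc 0 m).filter fun z => z.1.Coprime z.2).card ≤
      2 * ((Finset.Ioc 0 m ×ˢ Finset.Ioc 0 m).filter
        fun z => z.1 ≤ z.2 ∧ z.1.Coprime z.2).card := by
  set C := (Finset.Ioc 0 m ×ˢ Finset.Ioc 0 m).filter fun z => z.1 ≤ z.2 ∧ z.1.Coprime z.2 with hC
  calc _ ≤ (C ∪ C.image Prod.swap).card := by
        refine Finset.card_le_card ?_
        rintro ⟨a, b⟩ h
        simp only [hC, Finset.mem_union, Finset.mem_image, Finset.mem_filter, Finset.mem_product]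
          at h ⊢
        rcases le_total a b with hab | hab
        · exact Or.inl ⟨h.1, hab, h.2⟩
        · exact Or.inr ⟨(b, a), ⟨⟨h.1.2, h.1.1⟩, hab, h.2.symm⟩, rfl⟩
    _ ≤ C.card + C.card :=
        (Finset.card_union_le _ _).trans (Nat.add_le_add_left Finset.card_image_le _)
    _ = 2 * C.card := (two_mul _).symm

/-- Keep `1/9` exactly and telescope the rest with `1/(2k+3)² ≤ (1/(k+1) - 1/(k+2))/4`; the total is
`1/9 + 1/8`. -/
theorem sum_inv_odd_sq_le (K : ℕ) :
    ∑ k ∈ Finset.range K, 1 / (2 * (k : ℝ) + 3) ^ 2 ≤ 17 / 72 := by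
  have h : ∀ K : ℕ, ∑ k ∈ Finset.range (K + 1), 1 / (2 * (k : ℝ) + 3) ^ 2 ≤
      17 / 72 - 1 / (4 * ((K : ℝ) + 2)) := by
    intro K
    induction K with
    | zero => norm_num
    | succ K ih =>
      rw [Finset.sum_range_succ]
      have h1 : 1 / (2 * ((K + 1 : ℕ) : ℝ) + 3) ^ 2 ≤
          1 / (4 * ((K : ℝ) + 2)) - 1 / (4 * (((K + 1 : ℕ) : ℝ) + 2)) := by
        push_cast
        have hK : (0 : ℝ) ≤ K := by positivity
        rw [div_sub_div _ _ (by positivity) (by positivity), div_le_div_iff₀ (by positivity)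
          (by positivity)]
        nlinarith
      linarith
  rcases K with _ | K
  · norm_num
  · have := h K
    have h2 : 0 ≤ 1 / (4 * ((K : ℝ) + 2)) := by positivity
    linarith

theorem card_dvd_dvd (m d : ℕ) :
    ((Finset.Ioc 0 m ×ˢ Finset.Ioc 0 m).filter fun z => d ∣ z.1 ∧ d ∣ z.2).card =
      (m / d) ^ 2 := by
  rw [Finset.filter_product (d ∣ ·) (d ∣ ·), Finset.card_product, Nat.Ioc_filter_dvd_card_eq_div,
    sq]

/-- A non-coprime pair has a common divisor 2 or an odd one at least 3. The union bound over all odd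
numbers, prime or not, costs only `1/4 + 17/72`, leaving a share above the `1/2` needed later. -/
theorem card_coprime_ge (m : ℕ) :
    (37 / 72 : ℝ) * (m : ℝ) ^ 2 ≤
      (((Finset.Ioc 0 m ×ˢ Finset.Ioc 0 m).filter fun z => z.1.Coprime z.2).card : ℝ) := by
  set E := Finset.Ioc 0 m ×ˢ Finset.Ioc 0 m with hE
  have hcov : E.filter (fun z => ¬ z.1.Coprime z.2) ⊆ E.filter (fun z => 2 ∣ z.1 ∧ 2 ∣ z.2) ∪
      (Finset.range m).biUnion fun k => E.filter fun z => 2 * k + 3 ∣ z.1 ∧ 2 * k + 3 ∣ z.2 := by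
    rintro ⟨a, b⟩ h
    rw [Finset.mem_filter] at h
    obtain ⟨p, hp, ha, hb⟩ := Nat.Prime.not_coprime_iff_dvd.1 h.2
    rw [Finset.mem_union]
    rcases hp.eq_two_or_odd' with rfl | hodd
    · exact Or.inl (Finset.mem_filter.2 ⟨h.1, ha, hb⟩)
    · right
      obtain ⟨k, hk⟩ := hodd
      have hp2 := hp.two_le
      have ham : a ∈ Finset.Ioc 0 m := (Finset.mem_product.1 h.1).1
      rw [Finset.mem_Ioc] at ham
      have hpa := Nat.le_of_dvd ham.1 ha
      refine Finset.mem_biUnion.2 ⟨k - 1, Finset.mem_range.2 (by omega), Finset.mem_filter.2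
        ⟨h.1, ?_⟩⟩
      rw [show 2 * (k - 1) + 3 = p by omega]
      exact ⟨ha, hb⟩
  have hdiv : ∀ d : ℕ, 0 < d → (((m / d) ^ 2 : ℕ) : ℝ) ≤ (m : ℝ) ^ 2 * (1 / (d : ℝ) ^ 2) := by
    intro d hd
    have h1 : ((m / d : ℕ) : ℝ) ≤ (m : ℝ) / d := Nat.cast_div_le
    push_cast
    calc ((m / d : ℕ) : ℝ) ^ 2 ≤ ((m : ℝ) / d) ^ 2 := by gcongr
      _ = _ := by rw [div_pow]; ring
  have hbad : ((E.filter (fun z => ¬ z.1.Coprime z.2)).card : ℝ) ≤ 35 / 72 * (m : ℝ) ^ 2 := by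
    have h1 := (Finset.card_le_card hcov).trans ((Finset.card_union_le _ _).trans
      (Nat.add_le_add_left Finset.card_biUnion_le _))
    simp only [hE, card_dvd_dvd] at h1
    have h2 : ((E.filter (fun z => ¬ z.1.Coprime z.2)).card : ℝ) ≤
        (((m / 2) ^ 2 : ℕ) : ℝ) + ∑ k ∈ Finset.range m, (((m / (2 * k + 3)) ^ 2 : ℕ) : ℝ) := by
      exact_mod_cast h1
    have h3 : ∑ k ∈ Finset.range m, (((m / (2 * k + 3)) ^ 2 : ℕ) : ℝ) ≤ (m : ℝ) ^ 2 * (17 / 72) := by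
      calc _ ≤ ∑ k ∈ Finset.range m, (m : ℝ) ^ 2 * (1 / (2 * (k : ℝ) + 3) ^ 2) := by
            refine Finset.sum_le_sum fun k _ => ?_
            have := hdiv (2 * k + 3) (by omega)
            push_cast at this ⊢
            exact this
        _ ≤ _ := by
            rw [← Finset.mul_sum]
            exact mul_le_mul_of_nonneg_left (sum_inv_odd_sq_le m) (by positivity)
    have h4 := hdiv 2 (by omega)
    push_cast at h2 h3 h4
    linarith
  have htot := Finset.card_filter_add_card_filter_not (s := E) (fun z : ℕ × ℕ => z.1.Coprime z.2)
  have hEc : E.card = m ^ 2 := by rw [hE, Finset.card_product, Nat.card_Ioc, Nat.sub_zero, sq]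
  have htot' : ((E.filter (fun z => z.1.Coprime z.2)).card : ℝ) +
      ((E.filter (fun z => ¬ z.1.Coprime z.2)).card : ℝ) = (m : ℝ) ^ 2 := by
    rw [hEc] at htot
    exact_mod_cast htot
  linarith

theorem sq_le_four_mul_card_fareySet {m : ℕ} (hm : 100 ≤ m) :
    ((m : ℤ) + 1) ^ 2 ≤ 4 * (((fareySet m).card : ℤ) - 1) := by
  have h1 := card_coprime_ge m
  have h2 := card_coprime_le_two_mul m
  have h3 := card_coprime_lt_card_fareySet (show 0 < m by omega)
  have h4 : (((Finset.Ioc 0 m ×ˢ Finset.Ioc 0 m).filter fun z => z.1.Coprime z.2).card : ℝ) ≤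
      2 * (((fareySet m).card : ℝ) - 1) := by
    have h5 : ((Finset.Ioc 0 m ×ˢ Finset.Ioc 0 m).filter fun z => z.1.Coprime z.2).card + 2 ≤
      2 * (fareySet m).card := by omega
    have h6 : (((Finset.Ioc 0 m ×ˢ Finset.Ioc 0 m).filter fun z => z.1.Coprime z.2).card : ℝ) + 2 ≤
      2 * (fareySet m).card := by exact_mod_cast h5
    linarith
  have hm' : (100 : ℝ) ≤ m := by exact_mod_cast hm
  have : ((m : ℝ) + 1) ^ 2 ≤ 4 * (((fareySet m).card : ℝ) - 1) := by nlinarith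
  exact_mod_cast this

/-! ### Choice of parameters and conclusion -/

theorem eventually_exists_peak :
    ∀ᶠ n : ℕ in atTop, ∀ H : Finset (ℕ × ℕ), H ⊆ Finset.Icc 1 n ×ˢ Finset.Icc 1 n → H.Nonempty →
      ∃ p : MvPolynomial (Fin 2) ℝ,
        (p.totalDegree : ℝ) ≤ 6.308 * (n : ℝ) ^ (2 / 3 : ℝ) - 2 ∧
        ∃ h ∈ H,
          ∑ x ∈ H.erase h, |MvPolynomial.eval ![(x.1 : ℝ), (x.2 : ℝ)] p| <
            MvPolynomial.eval ![(h.1 : ℝ), (h.2 : ℝ)] p := by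
  filter_upwards [eventually_ge_atTop (100 ^ 3)] with n hn H hH hne
  set r : ℝ := (n : ℝ) ^ (1 / 3 : ℝ) with hr
  have hn' : ((100 : ℝ)) ^ 3 ≤ n := by exact_mod_cast hn
  have hr3 : r ^ 3 = n := by
    rw [hr, ← Real.rpow_natCast, ← Real.rpow_mul (by positivity)]
    norm_num
  have hr2 : (n : ℝ) ^ (2 / 3 : ℝ) = r ^ 2 := by
    rw [hr, ← Real.rpow_natCast, ← Real.rpow_mul (by positivity)]
    norm_num
  have hr0 : 0 ≤ r := by positivity
  have hr100 : 100 ≤ r := by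
    rw [← hr3] at hn'
    exact le_of_pow_le_pow_left₀ (by norm_num) hr0 hn'
  rw [hr2]
  -- Since `m + 1 > 2r`, the gaps total at least `(m+1)³/4 > 2n`.
  set m := ⌊2 * r⌋₊ with hm
  -- As `mn ≤ 2r⁴`, the requirement is roughly `e² ≥ 2.47 r⁴`, and `1.575² > 2.48`. The degree `4e ≤
  -- 6.3 r²` leaves `0.008 r²` to absorb the `-2`.
  set e := ⌊1.575 * r ^ 2⌋₊ with he
  have hm1 : (m : ℝ) ≤ 2 * r := Nat.floor_le (by positivity)
  have hm2 : 2 * r < m + 1 := Nat.lt_floor_add_one _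
  have he1 : (e : ℝ) ≤ 1.575 * r ^ 2 := Nat.floor_le (by positivity)
  have he2 : 1.575 * r ^ 2 < e + 1 := Nat.lt_floor_add_one _
  have hm100 : 100 ≤ m := Nat.le_floor (by push_cast; linarith)
  have hr2' : 10000 ≤ r ^ 2 := by nlinarith
  have hfarey := sq_le_four_mul_card_fareySet hm100
  have hcount : 2 * (n : ℤ) < (((fareySet m).card : ℤ) - 1) * (m + 1) := by
    have h1 : 8 * (n : ℝ) < ((m : ℝ) + 1) ^ 3 := by
      have : (2 * r) ^ 3 < ((m : ℝ) + 1) ^ 3 := pow_lt_pow_left₀ hm2 (by positivity) (by norm_num)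
      rw [← hr3]
      linarith [mul_pow 2 r 3]
    have h2 : 8 * (n : ℤ) < ((m : ℤ) + 1) ^ 3 := by exact_mod_cast h1
    have h3 : ((m : ℤ) + 1) ^ 2 * (m + 1) ≤ 4 * (((fareySet m).card : ℤ) - 1) * (m + 1) :=
      mul_le_mul_of_nonneg_right hfarey (by positivity)
    linarith [pow_succ ((m : ℤ) + 1) 2]
  obtain ⟨t, ht, t', ht', htt, h, hh, hmax, hmax'⟩ := exists_common_max hcount hH hne
  rw [mem_fareySet] at ht ht'
  have hN : ((m * n : ℕ) : ℝ) ≤ 2 * (r ^ 2) ^ 2 := by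
    push_cast
    rw [← hr3]
    calc (m : ℝ) * r ^ 3 ≤ 2 * r * r ^ 3 := by gcongr
      _ = _ := by ring
  have heN : e < m * n := by
    have h1 : (100 : ℝ) * r ^ 3 ≤ ((m * n : ℕ) : ℝ) := by
      push_cast
      rw [← hr3]
      gcongr
      exact_mod_cast hm100
    have h2 : (e : ℝ) < ((m * n : ℕ) : ℝ) := by nlinarith
    exact_mod_cast h2
  have hsq : 1.235 * (((m * n : ℕ) : ℝ) + e + 1) ≤ ((e : ℝ) + 1) ^ 2 := by
    have h1 : (1.575 * r ^ 2) ^ 2 ≤ ((e : ℝ) + 1) ^ 2 := by gcongr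
    nlinarith
  obtain ⟨G, hGd, hG0, hG⟩ := exists_poly_sum_sq_lt_sqrt_two heN hsq
  obtain ⟨p, hp, hpeak⟩ := exists_peak_of_common_max hGd hG0 hG hH hh htt ht.1 ht.2.1 ht.2.2
    ht'.1 ht'.2.1 ht'.2.2 hmax hmax'
  refine ⟨p, ?_, h, hh, hpeak⟩
  have h1 : (p.totalDegree : ℝ) ≤ 4 * e := by exact_mod_cast hp
  linarith

theorem theorem3 :
    ∀ᶠ n : ℕ in atTop,
      (∀ H : Finset (ℕ × ℕ), H ⊆ Finset.Icc 1 n ×ˢ Finset.Icc 1 n → H.Nonempty →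
        ∃ p : MvPolynomial (Fin 2) ℝ,
          (p.totalDegree : ℝ) ≤ 6.308 * (n : ℝ) ^ (2 / 3 : ℝ) - 2 ∧
          ∃ h ∈ H,
            ∑ x ∈ H.erase h, |MvPolynomial.eval ![(x.1 : ℝ), (x.2 : ℝ)] p| <
              MvPolynomial.eval ![(h.1 : ℝ), (h.2 : ℝ)] p) ∧
      (kappa₂ n : ℝ) ≤ 6.308 * (n : ℝ) ^ (2 / 3 : ℝ) ∧
      (kappaP₂ n : ℝ) ≤ 6.308 * (n : ℝ) ^ (2 / 3 : ℝ) := by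
  filter_upwards [eventually_exists_peak, eventually_ge_atTop (100 ^ 3)] with n hpeak hn
  set k := ⌊6.308 * (n : ℝ) ^ (2 / 3 : ℝ)⌋₊ with hk
  have hkle : (k : ℝ) ≤ 6.308 * (n : ℝ) ^ (2 / 3 : ℝ) := Nat.floor_le (by positivity)
  have hP : HasPeakPoly n k := by
    intro H hH hne
    obtain ⟨p, hp, hrest⟩ := hpeak H hH hne
    refine ⟨p, Nat.le_floor ?_, hrest⟩
    push_cast
    linarith
  -- From `n^(1/3) ≥ 100 > 6.308`.
  have hkn : k ≤ n := by
    have hn0 : (100 : ℝ) ^ 3 ≤ n := by exact_mod_cast hn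
    have h1 : (100 : ℝ) ≤ (n : ℝ) ^ (1 / 3 : ℝ) := by
      calc (100 : ℝ) = ((100 : ℝ) ^ 3) ^ (1 / 3 : ℝ) := by
            rw [← Real.rpow_natCast, ← Real.rpow_mul (by norm_num)]
            norm_num
        _ ≤ _ := Real.rpow_le_rpow (by norm_num) hn0 (by norm_num)
    have h2 : (n : ℝ) = (n : ℝ) ^ (1 / 3 : ℝ) * (n : ℝ) ^ (2 / 3 : ℝ) := by
      rw [← Real.rpow_add (by linarith)]
      norm_num
    have h3 : (0 : ℝ) ≤ (n : ℝ) ^ (2 / 3 : ℝ) := by positivity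
    have h4 : (k : ℝ) ≤ n := by nlinarith
    exact_mod_cast h4
  refine ⟨hpeak, ?_, ?_⟩
  · exact le_trans (by exact_mod_cast kappa₂_le_of_hasPeakPoly hP hkn) hkle
  · exact le_trans (by exact_mod_cast kappaP₂_le_of_hasPeakPoly hP hkn) hkle
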